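/- Let $N\ge 0$, $M\ge 1$ be integers, $\beta>0$, $\lambda=\tanh\beta$, $\mathcal H=\mathbb C^2$, and let $R_*\sigma=\lambda\sigma+(1-\lambda)\tfrac12\mathbb 1$ be the depolarizing channel. For a linear map $T:\mathcal B(\mathcal H^{\otimes M})\to\mathcal B(\mathcal H^{\otimes N})$ with predual $T_*$, determined by $\operatorname{tr}(T(X)\rho)=\operatorname{tr}(X\,T_*(\rho))$, the one-qubit fidelity is $$\mathcal F_{\rm one}(T)=\inf_{1\le i\le M}\ \inf_{\sigma}\ \operatorname{tr}\bigl(\sigma^{(i)}\,T_*((R_*\sigma)^{\otimes N})\bigr),$$ where $\sigma$ runs over the pure one-qubit states and $\sigma^{(i)}$ acts as $\sigma$ on the $i$-th qubit and as the identity on the others. Write $\mathcal H^{\otimes N}=\bigoplus_{s\in I[N]}\mathcal H_s\otimes\mathcal K_{N,s}$ for the decomposition under $U\mapsto U^{\otimes N}$, $U\in \mathrm{SU}(2)$. Here $I[N]=\{N/2,\,N/2-1,\,\dots\}\cap[0,\infty)$, $\mathcal H_s=\mathcal H_+^{\otimes 2s}$ is the symmetric subspace of $\mathcal H^{\otimes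 2s}$ (the spin-$s$ representation), and $\mathcal K_{N,s}$ is the multiplicity space. Let $S_n$ be the projector of $\mathcal H^{\otimes n}$ onto its symmetric subspace, and define $\hat Q_{2s}:\mathcal B(\mathcal H^{\otimes M})\to\mathcal B(\mathcal H_s)$ by $$\hat Q_{2s*}(\theta)=\tfrac{2s+1}{M+1}\,S_M(\theta\otimes\mathbb 1^{\otimes(M-2s)})S_M\ \text{ if } M>2s,\qquad \hat Q_{2s}(A)=S_{2s}(A\otimes\mathbb 1^{\otimes(2s-M)})S_{2s}\ \text{ if } M\le 2s .$$ The optimal purifier is $T^{\rm opt}(A)=\bigoplus_{s\in I[N]}\hat Q_{2s}(A)\otimes\mathbb 1_{\mathcal K_{N,s}}$. With $L_3$ the third component of angular momentum on $\mathcal H^{\otimes M}$ and $L_3^{(s)}$ that on $\mathcal H_s$, put $$w_N(s)=\frac{\sinh((2s+1)\beta)}{\sinh(\beta)\,(2\cosh\beta)^N}\dim\mathcal K_{N,s},\qquad \rho_s(\beta)=\frac{\sinh\beta}{\sinh((2s+1)\beta)}\,e^{2\beta L_3^{(s)}},$$ $$f_{\rm one}(M,\beta,s)=\tfrac12\bigl[1+\gamma(\hat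 Q_{2s*}(\rho_s(\beta)))\bigr],\qquad \gamma(\theta)=\tfrac1M\operatorname{tr}(2L_3\theta).$$ Then $$\mathcal F_{\rm one}(T^{\rm opt})=\sum_{s\in I[N]}w_N(s)\,f_{\rm one}(M,\beta,s),$$ and for every $s\in\{0,\tfrac12,1,\dots\}$ $$2f_{\rm one}(M,\beta,s)-1=\begin{cases}\dfrac{2s+1}{2s}\coth((2s+1)\beta)-\dfrac1{2s}\coth\beta & \text{if } 2s>M,\\[2mm] \dfrac1{2s+2}\,\dfrac{M+2}{M}\Bigl((2s+1)\coth((2s+1)\beta)-\coth\beta\Bigr)&\text{if } 2s\le M.\end{cases}$$ -/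

import Mathlib

noncomputable section

namespace QubitPurification

open Matrix

/-- Labels of the product basis of `(ℂ²)^{⊗N}`. -/
abbrev Cfg (N : ℕ) : Type := Fin N → Fin 2

/-- Operators on `(ℂ²)^{⊗N}`, as matrices in the product basis. -/
abbrev Op (N : ℕ) : Type := Matrix (Cfg N) (Cfg N) ℂ

/-- The tensor power `A^{⊗N}` of a one-qubit operator. -/
def tensorPow (N : ℕ) (A : Matrix (Fin 2) (Fin 2) ℂ) : Op N :=
  Matrix.of fun i j => ∏ k, A (i k) (j k)

/-- `A^{(k)} = 1 ⊗ ⋯ ⊗ A ⊗ ⋯ ⊗ 1`, with the one-qubit operator `A` in position `k`. -/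
def onSite {N : ℕ} (k : Fin N) (A : Matrix (Fin 2) (Fin 2) ℂ) : Op N :=
  Matrix.of fun i j => A (i k) (j k) * (if ∀ l, l ≠ k → i l = j l then 1 else 0)

/-- `A ⊗ 1^{⊗(m-n)}`, where `A` acts on the first `n` of `m` qubits. -/
def tensorOne {n m : ℕ} (h : n ≤ m) : Op n →ₗ[ℂ] Op m where
  toFun A := Matrix.of fun i j =>
    A (fun k => i (Fin.castLE h k)) (fun k => j (Fin.castLE h k)) *
      (if ∀ l : Fin m, n ≤ (l : ℕ) → i l = j l then 1 else 0)
  map_add' A B := by ext i j; simp only [Matrix.of_apply, Matrix.add_apply, add_mul]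
  map_smul' c A := by ext i j; simp

/-- The projector `S_n` of `(ℂ²)^{⊗n}` onto its symmetric (Bose) subspace: the average of the
unitaries that permute the tensor factors. -/
def symProj (n : ℕ) : Op n :=
  ((n.factorial : ℂ)⁻¹) •
    ∑ η : Equiv.Perm (Fin n), Matrix.of fun i j : Cfg n => if i ∘ η = j then (1 : ℂ) else 0

/-- The Pauli matrix `σ₃`. -/
def pauli3 : Matrix (Fin 2) (Fin 2) ℂ := !![1, 0; 0, -1]

/-- The third component of angular momentum on `N` qubits. -/
def L3 (N : ℕ) : Op N := (1 / 2 : ℂ) • ∑ k : Fin N, onSite k pauli3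

/-! ### Channels and the one-qubit fidelity -/

/-- The transpose of a linear map of matrix algebras for the pairing `(X, ρ) ↦ tr (X ρ)`. It sends
a map `T` in the Heisenberg picture to its predual `T_*`, and conversely. -/
def traceDual {a b : Type} [Fintype a] [DecidableEq a] [Fintype b] [DecidableEq b]
    (T : Matrix a a ℂ →ₗ[ℂ] Matrix b b ℂ) : Matrix b b ℂ →ₗ[ℂ] Matrix a a ℂ where
  toFun ρ := Matrix.of fun j i => (T (Matrix.single i j 1) * ρ).trace
  map_add' ρ ρ' := by ext i j; simp [mul_add]
  map_smul' c ρ := by ext i j; simp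

theorem trace_mul_traceDual {a b : Type} [Fintype a] [DecidableEq a] [Fintype b] [DecidableEq b]
    (T : Matrix a a ℂ →ₗ[ℂ] Matrix b b ℂ) (X : Matrix a a ℂ) (ρ : Matrix b b ℂ) :
    (T X * ρ).trace = (X * traceDual T ρ).trace := by
  conv_lhs => rw [Matrix.matrix_eq_sum_single X]
  have h : ∀ i j, T (Matrix.single i j (X i j)) = X i j • T (Matrix.single i j 1) := by
    intro i j
    rw [← map_smul, Matrix.smul_single, smul_eq_mul, mul_one]
  simp only [map_sum, h, Finset.sum_mul, Matrix.trace_sum, Matrix.smul_mul, Matrix.trace_smul,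
    smul_eq_mul]
  simp [Matrix.trace, Matrix.mul_apply, traceDual]

/-- The depolarizing channel `R_* σ = λ σ + (1 - λ) 1/2`. -/
def depolarize (lam : ℝ) (σ : Matrix (Fin 2) (Fin 2) ℂ) : Matrix (Fin 2) (Fin 2) ℂ :=
  (lam : ℂ) • σ + ((1 - lam) / 2 : ℂ) • (1 : Matrix (Fin 2) (Fin 2) ℂ)

/-- The pure one-qubit states `|φ⟩⟨φ|`, `‖φ‖ = 1`. -/
def pureStates : Set (Matrix (Fin 2) (Fin 2) ℂ) :=
  {σ | ∃ φ : Fin 2 → ℂ, star φ ⬝ᵥ φ = 1 ∧ σ = Matrix.vecMulVec φ (star φ)}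

/-- The one-qubit fidelity
`F_one(T) = inf_i inf_σ tr (σ^{(i)} T_*((R_* σ)^{⊗N}))` of a device `T` (in the Heisenberg
picture), for the noise parameter `λ`. -/
def fidelityOne {N M : ℕ} (lam : ℝ) (T : Op M →ₗ[ℂ] Op N) : ℝ :=
  ⨅ i : Fin M, ⨅ σ : pureStates,
    (onSite i σ.1 * traceDual T (tensorPow N (depolarize lam σ.1))).trace.re

/-! ### Decomposition of `(ℂ²)^{⊗N}` under `SU(2)`

A spin `s` is represented by the integer `n = 2s`. Its representation space `H_s` is the symmetric
subspace of `(ℂ²)^{⊗n}`, and the operators on `H_s` are the `A : Op n` with `S_n A S_n = A`. -/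

/-- The set `{2s | s ∈ I[N]}`. -/
def twoSpins (N : ℕ) : Finset ℕ := (Finset.range (N + 1)).filter fun n => n % 2 = N % 2

/-- A vector of `(ℂ²)^{⊗N} ⊗ (ℂ²)^{⊗n}` read as a matrix; the Euclidean inner product becomes
`⟨V, W⟩ = tr (V* W)`. -/
def toMat {a b : Type} [Fintype a] [Fintype b] :
    EuclideanSpace ℂ (a × b) →ₗ[ℂ] Matrix a b ℂ where
  toFun v := Matrix.of fun i j => v (i, j)
  map_add' v w := by ext i j; simp
  map_smul' c v := by ext i j; simp

/-- The multiplicity space `K_{N,s}`, `n = 2s`: the space `Hom_{SU(2)}(H_s, (ℂ²)^{⊗N})` of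
intertwiners, each extended by zero from `H_s` to `(ℂ²)^{⊗n}`. -/
def multSpace (N n : ℕ) : Submodule ℂ (EuclideanSpace ℂ (Cfg N × Cfg n)) where
  carrier := {v | toMat v * symProj n = toMat v ∧
    ∀ U ∈ Matrix.specialUnitaryGroup (Fin 2) ℂ,
      tensorPow N U * toMat v = toMat v * tensorPow n U}
  add_mem' := by
    rintro v w ⟨hv, hv'⟩ ⟨hw, hw'⟩
    refine ⟨by rw [map_add, Matrix.add_mul, hv, hw], fun U hU => ?_⟩
    rw [map_add, Matrix.mul_add, Matrix.add_mul, hv' U hU, hw' U hU]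
  zero_mem' := by simp
  smul_mem' := by
    rintro c v ⟨hv, hv'⟩
    refine ⟨by rw [map_smul, Matrix.smul_mul, hv], fun U hU => ?_⟩
    rw [map_smul, Matrix.smul_mul, Matrix.mul_smul, hv' U hU]

/-- The map `T^nat_s : A ↦ A ⊗ 1` from operators on `H_s`, `n = 2s`, to operators on the summand
`H_s ⊗ K_{N,s}` of `(ℂ²)^{⊗N}` (extended by zero to the other summands). For intertwiners
`V, W` one has `V* W = (tr (V* W) / (n + 1)) S_n`, so for an orthonormal basis `(V_k)` of `K_{N,s}`
the maps `√(n+1) V_k` are isometries of `H_s` onto pairwise orthogonal copies of it, and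
`A ⊗ 1 = ∑_k (n + 1) V_k A V_k*`, whatever the basis. -/
def natBlock (N n : ℕ) : Op n →ₗ[ℂ] Op N where
  toFun A := ((n : ℂ) + 1) •
    ∑ k, toMat (stdOrthonormalBasis ℂ (multSpace N n) k : EuclideanSpace ℂ (Cfg N × Cfg n)) * A *
      (toMat (stdOrthonormalBasis ℂ (multSpace N n) k : EuclideanSpace ℂ (Cfg N × Cfg n)))ᴴ
  map_add' A B := by
    simp only [Matrix.mul_add, Matrix.add_mul, Finset.sum_add_distrib, smul_add]
  map_smul' c A := by
    simp only [Matrix.mul_smul, Matrix.smul_mul, ← Finset.smul_sum, RingHom.id_apply]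
    rw [smul_comm]

/-- The natural purifier `⊕_s A_s ↦ ⊕_s A_s ⊗ 1`. -/
def natPurifier (N : ℕ) : ((n : twoSpins N) → Op n) →ₗ[ℂ] Op N :=
  ∑ n : twoSpins N, natBlock N n ∘ₗ LinearMap.proj n

/-! ### Optimal cloning and the optimal purifier -/

/-- The predual `θ ↦ (n+1)/(M+1) S_M (θ ⊗ 1^{⊗(M-n)}) S_M` of the optimal `n → M` cloner, for `θ`
on the symmetric subspace of `(ℂ²)^{⊗n}`. -/
def clonePredual {n M : ℕ} (h : n ≤ M) : Op n →ₗ[ℂ] Op M where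
  toFun θ := (((n : ℂ) + 1) / ((M : ℂ) + 1)) •
    (symProj M * tensorOne h (symProj n * θ * symProj n) * symProj M)
  map_add' θ θ' := by simp only [mul_add, add_mul, map_add, smul_add]
  map_smul' c θ := by
    simp only [Matrix.mul_smul, Matrix.smul_mul, map_smul, RingHom.id_apply]
    rw [smul_comm]

/-- The map `A ↦ S_n (A ⊗ 1^{⊗(n-M)}) S_n`, which discards `n - M` of `n` qubits. -/
def discard {M n : ℕ} (h : M ≤ n) : Op M →ₗ[ℂ] Op n where
  toFun A := symProj n * tensorOne h A * symProj n
  map_add' A B := by simp only [mul_add, add_mul, map_add]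
  map_smul' c A := by simp only [Matrix.mul_smul, Matrix.smul_mul, map_smul, RingHom.id_apply]

/-- The map `Q̂_n` (Heisenberg picture) from operators on `M` qubits to operators on the symmetric
subspace of `n` qubits: optimal cloning if `n < M`, discarding qubits if `M ≤ n`. -/
def hatQ (M n : ℕ) : Op M →ₗ[ℂ] Op n :=
  if h : n < M then traceDual (clonePredual h.le) else discard (not_lt.mp h)

/-- The optimal purifier `T^opt = T^nat ∘ ⊕_s Q̂_{2s}`. -/
def optPurifier (N M : ℕ) : Op M →ₗ[ℂ] Op N :=
  natPurifier N ∘ₗ LinearMap.pi fun n : twoSpins N => hatQ M n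

/-! ### The quantities in the fidelity formula -/

/-- The weight `w_N(s) = sinh((2s+1)β) / (sinh β (2 cosh β)^N) · dim K_{N,s}`, `n = 2s`. -/
def weight (N : ℕ) (β : ℝ) (n : ℕ) : ℝ :=
  Real.sinh (((n : ℝ) + 1) * β) / (Real.sinh β * (2 * Real.cosh β) ^ N) *
    (Module.finrank ℂ (multSpace N n) : ℝ)

/-- The state `ρ_s(β) = sinh β / sinh((2s+1)β) · exp(2β L₃^{(s)})`, `n = 2s`. The factor `S_n`
restricts `exp(2β L₃)`, which commutes with it, to the symmetric subspace `H_s`. -/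
def rhoSpin (β : ℝ) (n : ℕ) : Op n :=
  ((Real.sinh β / Real.sinh (((n : ℝ) + 1) * β) : ℝ) : ℂ) •
    (symProj n * NormedSpace.exp ((2 * β : ℂ) • L3 n))

/-- The parameter `γ(θ) = (1/M) tr (2 L₃ θ)` of a state `θ` on `M` qubits. -/
def gammaParam {M : ℕ} (θ : Op M) : ℝ :=
  1 / (M : ℝ) * (((2 : ℂ) • L3 M) * θ).trace.re

/-- `f_one(M, β, s) = (1 + γ(Q̂_{2s*}(ρ_s(β)))) / 2`, `n = 2s`. -/
def fOne (M : ℕ) (β : ℝ) (n : ℕ) : ℝ :=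
  1 / 2 * (1 + gammaParam (traceDual (hatQ M n) (rhoSpin β n)))

/-- The hyperbolic cotangent. -/
def coth (x : ℝ) : ℝ := Real.cosh x / Real.sinh x

end QubitPurification

end

/-!
The device sees a thermal state. In the direction of a unit vector `φ`, with `U ∈ SU(2)` taking
`|0⟩` to `φ`, the depolarized pure state is `U exp(β σ₃) U* / (2 cosh β)` for `λ = tanh β`, a
multiple of an element of `SL(2, ℂ)` (`depolarize_tanh_vecMulVec`). An intertwiner
`V : H_s → (ℂ²)^{⊗N}` of `SU(2)` also intertwines `exp(β σ₃)^{⊗n}`, because it preserves weights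
(`tensorPow_torus_mul`), and `V* V` is a multiple of `S_n` by Schur's lemma for the symmetric
subspace (`eq_smul_symProj_of_commute`). Hence the block of spin `s` in the natural purifier
contributes the state `U ρ_s(β) U*` with weight `w_N(s)` (`trace_natBlock_mul`).

The maps `Q̂` commute with `SU(2)` and do not distinguish the output qubits
(`trace_hatQ_conj_mul`, `hatQ_onSite_mul`). So the expression under the two infima in the
fidelity is a constant, and it may be computed for `φ = |0⟩`, where
`|0⟩⟨0| = (1 + σ₃) / 2` turns it into `f_one`, since `tr (Q̂(1) ρ_s(β)) = 1`
(`trace_hatQ_onSite_mul_rhoSpin`).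

It remains to evaluate `tr (2 L₃ Q̂_*(ρ_s(β)))`. Discarding `n - M` of `n` symmetric qubits
multiplies `2 L₃` by `M / n` (`discard_two_smul_L3`). For cloning, the observables `1` and `2 L₃`
are diagonal and only the diagonal entries `1 / (M choose m)` of `S_M` matter; tracing out one
qubit at a time is the recursion of Leibniz' harmonic triangle, which yields the factor
`(M + 2) / (n + 2)` (`sum_restrict_mul_wt_mul_inv_choose`). Finally `tr (2 L₃ ρ_s(β))` is the
logarithmic derivative of the partition function `sinh ((n + 1) β) / sinh β`
(`sum_weights_mul_exp`).
-/

noncomputable section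

namespace QubitPurification

open Matrix

/-! ### Product operators and permutations of the tensor factors -/

/-- The product operator `A₀ ⊗ A₁ ⊗ ⋯` on `(ℂ²)^{⊗N}`. -/
def prodOp {N : ℕ} (A : Fin N → Matrix (Fin 2) (Fin 2) ℂ) : Op N :=
  Matrix.of fun i j => ∏ k, A k (i k) (j k)

/-- The unitary that permutes the tensor factors by `η`. -/
def permOp {n : ℕ} (η : Equiv.Perm (Fin n)) : Op n :=
  Matrix.of fun i j : Cfg n => if i ∘ η = j then (1 : ℂ) else 0

theorem prodOp_mul {N : ℕ} (A B : Fin N → Matrix (Fin 2) (Fin 2) ℂ) :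
    prodOp A * prodOp B = prodOp (A * B) := by
  ext i j
  simp only [prodOp, Matrix.mul_apply, Matrix.of_apply, Pi.mul_apply, Finset.prod_univ_sum,
    Fintype.piFinset_univ, Finset.prod_mul_distrib]

theorem prodOp_one {N : ℕ} : prodOp (1 : Fin N → Matrix (Fin 2) (Fin 2) ℂ) = 1 := by
  ext i j
  simp only [prodOp, Matrix.of_apply, Pi.one_apply, Matrix.one_apply, Finset.prod_ite_zero]
  simp [funext_iff]

theorem conjTranspose_prodOp {N : ℕ} (A : Fin N → Matrix (Fin 2) (Fin 2) ℂ) :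
    (prodOp A)ᴴ = prodOp fun k => (A k)ᴴ := by
  ext i j
  simp [prodOp, Matrix.conjTranspose_apply]

theorem tensorPow_eq_prodOp (N : ℕ) (A : Matrix (Fin 2) (Fin 2) ℂ) :
    tensorPow N A = prodOp fun _ => A := rfl

theorem tensorPow_mul (N : ℕ) (A B : Matrix (Fin 2) (Fin 2) ℂ) :
    tensorPow N A * tensorPow N B = tensorPow N (A * B) :=
  prodOp_mul _ _

theorem tensorPow_one (N : ℕ) : tensorPow N 1 = 1 := prodOp_one

theorem conjTranspose_tensorPow (N : ℕ) (A : Matrix (Fin 2) (Fin 2) ℂ) :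
    (tensorPow N A)ᴴ = tensorPow N Aᴴ :=
  conjTranspose_prodOp _

theorem tensorPow_smul (N : ℕ) (c : ℂ) (A : Matrix (Fin 2) (Fin 2) ℂ) :
    tensorPow N (c • A) = c ^ N • tensorPow N A := by
  ext i j
  simp [tensorPow, Finset.prod_mul_distrib]

theorem onSite_eq_prodOp {N : ℕ} (k : Fin N) (A : Matrix (Fin 2) (Fin 2) ℂ) :
    onSite k A = prodOp (Function.update 1 k A) := by
  ext i j
  simp only [onSite, prodOp, Matrix.of_apply]
  rw [← Finset.mul_prod_erase _ _ (Finset.mem_univ k), Function.update_self]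
  congr 1
  rw [Finset.prod_congr rfl (g := fun l => if i l = j l then (1 : ℂ) else 0), Finset.prod_ite_zero]
  · simp
  · intro l hl
    rw [Function.update_of_ne (Finset.ne_of_mem_erase hl), Pi.one_apply, Matrix.one_apply]

/-- A linear map on operators is determined by its values on product operators. -/
theorem linearMap_ext_prodOp {n : ℕ} {V : Type*} [AddCommGroup V] [Module ℂ V]
    {f g : Op n →ₗ[ℂ] V} (h : ∀ A, f (prodOp A) = g (prodOp A)) : f = g := by
  refine Matrix.ext_linearMap _ fun i j => LinearMap.ext_ring ?_
  have hs : (Matrix.single i j (1 : ℂ) : Op n) =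
      prodOp fun k => Matrix.single (i k) (j k) (1 : ℂ) := by
    ext a b
    simp only [prodOp, Matrix.of_apply, Matrix.single_apply, Finset.prod_ite_zero]
    simp [funext_iff, forall_and]
  simpa [hs] using h _

theorem tensorOne_prodOp {n m : ℕ} (h : n ≤ m) (A : Fin n → Matrix (Fin 2) (Fin 2) ℂ) :
    tensorOne h (prodOp A) =
      prodOp fun k : Fin m => if hk : (k : ℕ) < n then A ⟨k, hk⟩ else 1 := by
  ext i j
  simp only [tensorOne, prodOp, LinearMap.coe_mk, AddHom.coe_mk, Matrix.of_apply]
  obtain ⟨d, rfl⟩ := Nat.exists_eq_add_of_le h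
  rw [Fin.prod_univ_add]
  congr 1
  · refine Finset.prod_congr rfl fun k _ => ?_
    simp [Fin.castLE, Fin.castAdd]
  · simp only [Fin.val_natAdd, not_lt.mpr (Nat.le_add_right _ _), dite_false, Matrix.one_apply,
      Finset.prod_ite_zero, Finset.prod_const_one]
    congr 1
    rw [eq_iff_iff]
    refine ⟨fun H l _ => H _ (by simp), fun H l hl => ?_⟩
    have := H (Fin.subNat n (l.cast (add_comm n d)) hl) (Finset.mem_univ _)
    simpa using this

theorem tensorOne_one {n m : ℕ} (h : n ≤ m) : tensorOne h (1 : Op n) = 1 := by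
  rw [← prodOp_one, tensorOne_prodOp, ← prodOp_one]
  congr 1
  ext k
  simp

theorem tensorOne_mul {n m : ℕ} (h : n ≤ m) (X Y : Op n) :
    tensorOne h (X * Y) = tensorOne h X * tensorOne h Y := by
  have key : (LinearMap.mul ℂ (Op n)).compr₂ (tensorOne h) =
      (LinearMap.mul ℂ (Op m)).compl₁₂ (tensorOne h) (tensorOne h) := by
    refine linearMap_ext_prodOp fun A => linearMap_ext_prodOp fun B => ?_
    simp only [LinearMap.compr₂_apply, LinearMap.mul_apply', LinearMap.compl₁₂_apply, prodOp_mul,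
      tensorOne_prodOp]
    congr 1
    ext1 k
    by_cases hk : (k : ℕ) < n <;> simp [hk]
  exact LinearMap.congr_fun₂ key X Y

/-- Embedding operators on the first `n` of `m` qubits is equivariant, because `U 1 U⁻¹ = 1` on
the remaining ones. -/
theorem tensorOne_conj {n m : ℕ} (h : n ≤ m) {U V : Matrix (Fin 2) (Fin 2) ℂ} (hUV : U * V = 1)
    (X : Op n) :
    tensorOne h (tensorPow n U * X * tensorPow n V) =
      tensorPow m U * tensorOne h X * tensorPow m V := by
  have key : tensorOne h ∘ₗ LinearMap.mulLeftRight ℂ (tensorPow n U, tensorPow n V) =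
      LinearMap.mulLeftRight ℂ (tensorPow m U, tensorPow m V) ∘ₗ tensorOne h := by
    refine linearMap_ext_prodOp fun A => ?_
    simp only [LinearMap.comp_apply, LinearMap.mulLeftRight_apply, tensorPow_eq_prodOp, prodOp_mul,
      tensorOne_prodOp]
    congr 1
    ext1 k
    by_cases hk : (k : ℕ) < n <;> simp [hk, hUV]
  exact LinearMap.congr_fun key X

theorem onSite_conj {N : ℕ} (k : Fin N) {U V : Matrix (Fin 2) (Fin 2) ℂ} (hUV : U * V = 1)
    (A : Matrix (Fin 2) (Fin 2) ℂ) :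
    onSite k (U * A * V) = tensorPow N U * onSite k A * tensorPow N V := by
  simp only [onSite_eq_prodOp, tensorPow_eq_prodOp, prodOp_mul]
  congr 1
  ext1 l
  by_cases hl : l = k
  · subst hl; simp
  · simp [hl, hUV]

theorem tensorOne_onSite {n m : ℕ} (h : n ≤ m) (k : Fin n) (A : Matrix (Fin 2) (Fin 2) ℂ) :
    tensorOne h (onSite k A) = onSite (Fin.castLE h k) A := by
  rw [onSite_eq_prodOp, onSite_eq_prodOp, tensorOne_prodOp]
  congr 1
  ext1 l
  by_cases hl : (l : ℕ) < n
  · by_cases hk : l = Fin.castLE h k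
    · subst hk; simp
    · have : (⟨l, hl⟩ : Fin n) ≠ k := fun e => hk (by ext; simp [← e])
      simp [hl, hk, this]
  · have : l ≠ Fin.castLE h k := fun e => hl (by rw [e]; exact k.2)
    simp [hl, this]

theorem symProj_eq (n : ℕ) :
    symProj n = ((n.factorial : ℂ)⁻¹) • ∑ η : Equiv.Perm (Fin n), permOp η := rfl

theorem permOp_mul_apply {n : ℕ} (η : Equiv.Perm (Fin n)) (X : Op n) (i j : Cfg n) :
    (permOp η * X) i j = X (i ∘ η) j := by
  simp [permOp, Matrix.mul_apply]

theorem permOp_mul_permOp {n : ℕ} (η ξ : Equiv.Perm (Fin n)) :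
    permOp η * permOp ξ = permOp (η * ξ) := by
  ext i j
  rw [permOp_mul_apply]
  rfl

theorem mul_permOp_apply {n : ℕ} (η : Equiv.Perm (Fin n)) (X : Op n) (i j : Cfg n) :
    (X * permOp η) i j = X i (j ∘ ⇑η⁻¹) := by
  have : ∀ a : Cfg n, a ∘ η = j ↔ a = j ∘ ⇑η⁻¹ := fun a => by
    constructor
    · rintro rfl; ext; simp
    · rintro rfl; ext; simp
  simp [permOp, Matrix.mul_apply, this]

theorem permOp_mul_prodOp {n : ℕ} (η : Equiv.Perm (Fin n))
    (A : Fin n → Matrix (Fin 2) (Fin 2) ℂ) :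
    permOp η * prodOp A = prodOp (A ∘ ⇑η⁻¹) * permOp η := by
  ext i j
  rw [permOp_mul_apply, mul_permOp_apply]
  simp only [prodOp, Matrix.of_apply]
  rw [← Equiv.prod_comp η fun x => (A ∘ ⇑η⁻¹) x (i x) ((j ∘ ⇑η⁻¹) x)]
  simp

theorem permOp_mul_symProj {n : ℕ} (η : Equiv.Perm (Fin n)) :
    permOp η * symProj n = symProj n := by
  simp only [symProj_eq, Matrix.mul_smul, Finset.mul_sum, permOp_mul_permOp]
  rw [Fintype.sum_equiv (Equiv.mulLeft η) (fun ξ => permOp (η * ξ)) permOp fun _ => rfl]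

theorem symProj_mul_permOp {n : ℕ} (η : Equiv.Perm (Fin n)) :
    symProj n * permOp η = symProj n := by
  simp only [symProj_eq, Matrix.smul_mul, Finset.sum_mul, permOp_mul_permOp]
  rw [Fintype.sum_equiv (Equiv.mulRight η) (fun ξ => permOp (ξ * η)) permOp fun _ => rfl]

theorem symProj_mul_of_permOp_mul {n : ℕ} {X : Op n} (hX : ∀ η, permOp η * X = X) :
    symProj n * X = X := by
  have : (n.factorial : ℂ) ≠ 0 := by exact_mod_cast n.factorial_ne_zero
  simp [symProj_eq, Finset.sum_mul, hX, Fintype.card_perm, ← Nat.cast_smul_eq_nsmul ℂ,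
    smul_smul, this]

theorem symProj_mul_self (n : ℕ) : symProj n * symProj n = symProj n :=
  symProj_mul_of_permOp_mul permOp_mul_symProj

theorem symProj_mul_tensorPow (n : ℕ) (A : Matrix (Fin 2) (Fin 2) ℂ) :
    symProj n * tensorPow n A = tensorPow n A * symProj n := by
  simp only [symProj_eq, Matrix.smul_mul, Matrix.mul_smul, Finset.sum_mul, Finset.mul_sum,
    tensorPow_eq_prodOp, permOp_mul_prodOp]
  rfl

/-- On the symmetric subspace a one-qubit operator acts alike at all positions. -/
theorem symProj_onSite_symProj {n : ℕ} (k l : Fin n) (A : Matrix (Fin 2) (Fin 2) ℂ) :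
    symProj n * onSite k A * symProj n = symProj n * onSite l A * symProj n := by
  have h : permOp (Equiv.swap k l) * onSite k A = onSite l A * permOp (Equiv.swap k l) := by
    rw [onSite_eq_prodOp, onSite_eq_prodOp, permOp_mul_prodOp]
    congr 2
    ext1 x
    simp only [Function.comp_apply, Equiv.swap_inv]
    by_cases hx : x = l
    · subst hx; simp
    · rw [Function.update_of_ne hx, Function.update_of_ne]
      · rfl
      · intro e
        exact hx (by rw [← Equiv.swap_apply_self k l x, e, Equiv.swap_apply_left])
  calc symProj n * onSite k A * symProj n
      = symProj n * permOp (Equiv.swap k l) * onSite k A * symProj n := by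
        rw [symProj_mul_permOp]
    _ = symProj n * onSite l A * (permOp (Equiv.swap k l) * symProj n) := by
        rw [Matrix.mul_assoc (symProj n), h]; simp only [Matrix.mul_assoc]
    _ = _ := by rw [permOp_mul_symProj]

theorem tensorOne_permOp {n m : ℕ} (h : n ≤ m) (η : Equiv.Perm (Fin n)) :
    tensorOne h (permOp η) = permOp (η.viaFintypeEmbedding (Fin.castLEEmb h)) := by
  ext i j
  have key : (i ∘ η.viaFintypeEmbedding (Fin.castLEEmb h) = j) ↔
      ((fun k => i (Fin.castLE h k)) ∘ η = fun k => j (Fin.castLE h k)) ∧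
        ∀ l : Fin m, n ≤ (l : ℕ) → i l = j l := by
    have hl : ∀ l : Fin m, n ≤ (l : ℕ) → l ∉ Set.range (Fin.castLEEmb h) := by
      rintro l hl ⟨k, rfl⟩
      exact absurd k.2 (not_lt.mpr hl)
    have hk : ∀ k : Fin n, η.viaFintypeEmbedding (Fin.castLEEmb h) (Fin.castLE h k) =
        Fin.castLE h (η k) := fun k =>
      Equiv.Perm.viaFintypeEmbedding_apply_image η (Fin.castLEEmb h) k
    constructor
    · rintro rfl
      refine ⟨funext fun k => by simp [hk], fun l hln => ?_⟩
      simp [Equiv.Perm.viaFintypeEmbedding_apply_notMem_range η (Fin.castLEEmb h) (hl l hln)]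
    · rintro ⟨h1, h2⟩
      funext l
      by_cases hln : n ≤ (l : ℕ)
      · simp [Equiv.Perm.viaFintypeEmbedding_apply_notMem_range η (Fin.castLEEmb h) (hl l hln),
          h2 l hln]
      · have : l = Fin.castLE h ⟨l, not_le.mp hln⟩ := rfl
        rw [this, Function.comp_apply, hk]
        exact congrFun h1 _
  simp only [tensorOne, permOp, LinearMap.coe_mk, AddHom.coe_mk, Matrix.of_apply, key, ite_and,
    ite_mul, one_mul, zero_mul]

theorem symProj_mul_tensorOne_symProj {n m : ℕ} (h : n ≤ m) :
    symProj m * tensorOne h (symProj n) = symProj m := by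
  have hn : (n.factorial : ℂ) ≠ 0 := by exact_mod_cast n.factorial_ne_zero
  simp [symProj_eq n, Finset.mul_sum, tensorOne_permOp, symProj_mul_permOp, Fintype.card_perm,
    ← Nat.cast_smul_eq_nsmul ℂ, smul_smul, hn]

/-! ### Weights of the product basis -/

/-- The number of qubits in state `1` in a product basis vector. -/
def ones {n : ℕ} (i : Cfg n) : ℕ := (Finset.univ.filter fun k => i k = 1).card

/-- The weight of a product basis vector: its eigenvalue for `2 L₃`. -/
def wt {n : ℕ} (i : Cfg n) : ℝ := (n : ℝ) - 2 * ones i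

theorem ones_le {n : ℕ} (i : Cfg n) : ones i ≤ n :=
  (Finset.card_filter_le _ _).trans (by simp)

theorem ones_comp {n : ℕ} (i : Cfg n) (η : Equiv.Perm (Fin n)) : ones (i ∘ η) = ones i := by
  unfold ones
  rw [← Finset.card_map η.toEmbedding]
  congr 1
  ext k
  simp only [Finset.mem_map, Finset.mem_filter, Finset.mem_univ, true_and, Function.comp_apply,
    Equiv.coe_toEmbedding]
  exact ⟨by rintro ⟨a, ha, rfl⟩; exact ha, fun h => ⟨η.symm k, by simpa using h, by simp⟩⟩

theorem card_fiber_one {n : ℕ} (i : Cfg n) : Fintype.card {k // i k = 1} = ones i :=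
  Fintype.card_subtype _

theorem card_fiber_zero {n : ℕ} (i : Cfg n) : Fintype.card {k // i k = 0} = n - ones i := by
  have h : ∀ k, i k = 0 ↔ ¬ i k = 1 := fun k => by omega
  rw [Fintype.card_congr (Equiv.subtypeEquivRight h), Fintype.card_subtype_compl, card_fiber_one,
    Fintype.card_fin]

/-- Two configurations with the same number of ones differ by a permutation of the qubits. -/
theorem exists_comp_eq_of_ones_eq {n : ℕ} {i j : Cfg n} (h : ones i = ones j) :
    ∃ η : Equiv.Perm (Fin n), i ∘ η = j := by
  have e : ∀ c, Nonempty ({a // j a = c} ≃ {b // i b = c}) := by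
    intro c
    refine Fintype.card_eq.mp ?_
    fin_cases c
    · exact (card_fiber_zero j).trans (h ▸ (card_fiber_zero i).symm)
    · exact (card_fiber_one j).trans (h ▸ (card_fiber_one i).symm)
  exact ⟨Equiv.ofFiberEquiv fun c => (e c).some, funext fun a => Equiv.ofFiberEquiv_map _ a⟩

theorem sum_pauli3 {n : ℕ} (i : Cfg n) :
    ∑ k, pauli3 (i k) (i k) = (wt i : ℂ) := by
  have : ∀ a : Fin 2, pauli3 a a = 1 - 2 * (if a = 1 then 1 else 0) := by
    intro a; fin_cases a <;> norm_num [pauli3]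
  simp only [this, Finset.sum_sub_distrib, ← Finset.mul_sum, Finset.sum_boole, wt, ones]
  simp

theorem onSite_diagonal {n : ℕ} (k : Fin n) (d : Fin 2 → ℂ) :
    onSite k (Matrix.diagonal d) = Matrix.diagonal fun i => d (i k) := by
  ext i j
  by_cases h : i = j
  · subst h; simp [onSite]
  · rw [Matrix.diagonal_apply_ne _ h]
    simp only [onSite, Matrix.of_apply, mul_ite, mul_one, mul_zero, ite_eq_right_iff]
    intro hl
    refine Matrix.diagonal_apply_ne _ fun hk => h (funext fun l => ?_)
    by_cases hlk : l = k
    · rw [hlk, hk]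
    · exact hl l hlk

theorem pauli3_eq_diagonal : pauli3 = Matrix.diagonal fun a => pauli3 a a := by
  ext a b; fin_cases a <;> fin_cases b <;> simp [pauli3]

theorem two_smul_L3 (n : ℕ) : (2 : ℂ) • L3 n = Matrix.diagonal fun i => (wt i : ℂ) := by
  have : ∀ k : Fin n, onSite k pauli3 = Matrix.diagonal fun i => pauli3 (i k) (i k) := fun k => by
    conv_lhs => rw [pauli3_eq_diagonal]
    exact onSite_diagonal k _
  ext i j
  simp only [L3, this, smul_smul, Matrix.smul_apply, Matrix.sum_apply]
  by_cases h : i = j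
  · subst h; simp [sum_pauli3]
  · simp [h]

/-- The one-qubit operator `exp (c σ₃)`. -/
def torus (c : ℂ) : Matrix (Fin 2) (Fin 2) ℂ :=
  Matrix.diagonal ![Complex.exp c, Complex.exp (-c)]

theorem torus_mem_specialUnitaryGroup (θ : ℝ) :
    torus (θ * Complex.I) ∈ Matrix.specialUnitaryGroup (Fin 2) ℂ := by
  have h1 : Complex.exp (-(θ * Complex.I)) * Complex.exp (θ * Complex.I) = 1 := by
    rw [← Complex.exp_add]; simp
  have h2 : Complex.exp (θ * Complex.I) * Complex.exp (-(θ * Complex.I)) = 1 := by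
    rw [mul_comm, h1]
  rw [Matrix.mem_specialUnitaryGroup_iff, Matrix.mem_unitaryGroup_iff]
  refine ⟨?_, by simp [torus, h2]⟩
  ext a b
  fin_cases a <;> fin_cases b <;>
    simp [torus, Matrix.star_eq_conjTranspose, Matrix.diagonal_conjTranspose, ← Complex.exp_conj,
      h1, h2]

theorem tensorPow_torus (n : ℕ) (c : ℂ) :
    tensorPow n (torus c) = Matrix.diagonal fun i => Complex.exp (c * wt i) := by
  ext i j
  by_cases h : i = j
  · subst h
    have : ∀ a : Fin 2, torus c a a = Complex.exp (c * pauli3 a a) := by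
      intro a; fin_cases a <;> simp [torus, pauli3]
    rw [Matrix.diagonal_apply_eq, ← sum_pauli3, Finset.mul_sum, Complex.exp_sum]
    simp [tensorPow, this]
  · obtain ⟨k, hk⟩ := Function.ne_iff.mp h
    rw [Matrix.diagonal_apply_ne _ h]
    exact Finset.prod_eq_zero (Finset.mem_univ k) (Matrix.diagonal_apply_ne _ hk)

theorem exp_two_mul_smul_L3 (n : ℕ) (β : ℝ) :
    NormedSpace.exp ((2 * β : ℂ) • L3 n) = tensorPow n (torus β) := by
  rw [mul_comm, ← smul_smul, two_smul_L3, ← Matrix.diagonal_smul, Matrix.exp_diagonal,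
    tensorPow_torus]
  congr 1
  ext i
  rw [Pi.coe_exp, ← Complex.exp_eq_exp_ℂ]
  simp

/-- An intertwiner of `SU(2)` preserves weights. If `i` and `j` have different weights `a` and `b`,
the rotation by the angle `π / (a - b)` has phases on the two vectors which differ by a sign. -/
theorem wt_eq_of_intertwiner {N n : ℕ} {V : Matrix (Cfg N) (Cfg n) ℂ}
    (hV : ∀ U ∈ Matrix.specialUnitaryGroup (Fin 2) ℂ, tensorPow N U * V = V * tensorPow n U)
    {i : Cfg N} {j : Cfg n} (hij : V i j ≠ 0) : wt i = wt j := by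
  by_contra hne
  have hsub : ((wt i : ℂ) - wt j) ≠ 0 := by
    exact_mod_cast sub_ne_zero.mpr hne
  have h := congrFun₂ (hV _ (torus_mem_specialUnitaryGroup (Real.pi / (wt i - wt j)))) i j
  rw [tensorPow_torus, tensorPow_torus, Matrix.diagonal_mul, Matrix.mul_diagonal,
    mul_comm] at h
  have h := mul_left_cancel₀ hij h
  have e : ((Real.pi / (wt i - wt j) : ℝ) * Complex.I * wt i : ℂ) =
      Real.pi * Complex.I + (Real.pi / (wt i - wt j) : ℝ) * Complex.I * wt j := by
    push_cast
    field_simp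
    ring
  rw [e, Complex.exp_add, Complex.exp_pi_mul_I] at h
  exact Complex.exp_ne_zero _ (by linear_combination (-1 / 2 : ℂ) * h)

/-- Intertwiners of `SU(2)` also intertwine the non-unitary operators `exp (c σ₃)^{⊗n}`. -/
theorem tensorPow_torus_mul {N n : ℕ} {V : Matrix (Cfg N) (Cfg n) ℂ}
    (hV : ∀ U ∈ Matrix.specialUnitaryGroup (Fin 2) ℂ, tensorPow N U * V = V * tensorPow n U)
    (c : ℂ) : tensorPow N (torus c) * V = V * tensorPow n (torus c) := by
  ext i j
  rw [tensorPow_torus, tensorPow_torus, Matrix.diagonal_mul, Matrix.mul_diagonal]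
  by_cases hij : V i j = 0
  · simp [hij]
  · rw [wt_eq_of_intertwiner hV hij, mul_comm]

/-! ### Sums over the product basis -/

/-- The permutations that fix a configuration form a group of order `k! (n - k)!`, where `k` is the
number of its ones. -/
theorem symProj_apply_self {n : ℕ} (i : Cfg n) :
    symProj n i i = ((n.choose (ones i) : ℂ))⁻¹ := by
  have hc : ((Finset.univ.filter fun η : Equiv.Perm (Fin n) => i ∘ η = i).card : ℂ) =
      (ones i).factorial * (n - ones i).factorial := by
    have h := DomMulAct.stabilizer_card i
    rw [Fin.prod_univ_two, card_fiber_zero, card_fiber_one, Fintype.card_subtype] at h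
    rw [h]; push_cast; ring
  have h1 : ((n.factorial : ℂ)) ≠ 0 := by exact_mod_cast n.factorial_ne_zero
  have h2 : ((ones i).factorial : ℂ) ≠ 0 := by exact_mod_cast (ones i).factorial_ne_zero
  have h3 : ((n - ones i).factorial : ℂ) ≠ 0 := by exact_mod_cast (n - ones i).factorial_ne_zero
  simp only [symProj_eq, permOp, Matrix.smul_apply, Matrix.sum_apply, Matrix.of_apply,
    Finset.sum_boole, hc, smul_eq_mul, Nat.cast_choose ℂ (ones_le i)]
  field_simp

/-- Each number of ones contributes once to a sum over the product basis that is weighted by the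
diagonal of `S_n`. -/
theorem sum_inv_choose_mul (n : ℕ) (f : ℕ → ℂ) :
    ∑ i : Cfg n, ((n.choose (ones i) : ℂ))⁻¹ * f (ones i) = ∑ m ∈ Finset.range (n + 1), f m := by
  have h := Finset.sum_powerset_apply_card (fun m => ((n.choose m : ℂ))⁻¹ * f m)
    (x := (Finset.univ : Finset (Fin n)))
  rw [Finset.card_univ, Fintype.card_fin, Finset.powerset_univ] at h
  refine Eq.trans ?_ (h.trans (Finset.sum_congr rfl fun m hm => ?_))
  · refine Finset.sum_bij' (fun i _ => Finset.univ.filter fun k => i k = 1)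
      (fun s _ k => if k ∈ s then 1 else 0) (by simp) (by simp) ?_ ?_ (fun _ _ => rfl)
    · intro i _
      ext k
      have : i k = 0 ∨ i k = 1 := by omega
      rcases this with h | h <;> simp [h]
    · intro s _
      ext k
      simp
  · have : (n.choose m : ℂ) ≠ 0 := by
      exact_mod_cast (Nat.choose_pos (Nat.lt_succ_iff.mp (Finset.mem_range.mp hm))).ne'
    rw [nsmul_eq_mul, mul_inv_cancel_left₀ this]

theorem trace_symProj (n : ℕ) : (symProj n).trace = n + 1 := by
  have h := sum_inv_choose_mul n fun _ => 1
  simpa [Matrix.trace, symProj_apply_self] using h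

/-- The restriction of a configuration of `m` qubits to the first `n`. -/
def restrict {n m : ℕ} (h : n ≤ m) (i : Cfg m) : Cfg n := fun k => i (Fin.castLE h k)

theorem sum_cfg_succ {n m : ℕ} (h : n ≤ m) (G : Cfg n → ℂ) (f : ℕ → ℂ) :
    ∑ i : Cfg (m + 1), G (restrict (h.trans m.le_succ) i) * f (ones i) =
      ∑ j : Cfg m, G (restrict h j) * (f (ones j) + f (ones j + 1)) := by
  rw [← (Fin.snocEquiv fun _ => Fin 2).sum_comp, Fintype.sum_prod_type, Fin.sum_univ_two,
    ← Finset.sum_add_distrib]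
  have hr : ∀ (a : Fin 2) (j : Cfg m),
      restrict (h.trans m.le_succ) (Fin.snocEquiv (fun _ => Fin 2) (a, j)) = restrict h j := by
    intro a j
    funext k
    exact Fin.snoc_castSucc (α := fun _ => Fin 2) a j (Fin.castLE h k)
  have ho : ∀ (a : Fin 2) (j : Cfg m), ones (Fin.snocEquiv (fun _ => Fin 2) (a, j)) =
      ones j + if a = 1 then 1 else 0 := by
    intro a j
    simp only [ones, Finset.card_filter, Fin.sum_univ_castSucc, Fin.snocEquiv_apply,
      Fin.snoc_castSucc, Fin.snoc_last]
  refine Finset.sum_congr rfl fun j _ => ?_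
  simp [hr, ho, mul_add]

theorem choose_succ_cast {m k : ℕ} (hk : k ≤ m) :
    ((m + 1).choose k : ℂ)⁻¹ = (m + 1 - k) / (m + 1) * (m.choose k : ℂ)⁻¹ ∧
      ((m + 1).choose (k + 1) : ℂ)⁻¹ = (k + 1) / (m + 1) * (m.choose k : ℂ)⁻¹ := by
  have h0 : (m.choose k : ℂ) ≠ 0 := by exact_mod_cast (Nat.choose_pos hk).ne'
  have h1 : ((m + 1).choose k : ℂ) ≠ 0 := by
    exact_mod_cast (Nat.choose_pos (hk.trans m.le_succ)).ne'
  have h2 : ((m + 1).choose (k + 1) : ℂ) ≠ 0 := by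
    exact_mod_cast (Nat.choose_pos (Nat.succ_le_succ hk)).ne'
  have h3 : (m + 1 : ℂ) ≠ 0 := by exact_mod_cast m.succ_ne_zero
  have e1 : (m.choose k : ℂ) * (m + 1) = (m + 1).choose k * (m + 1 - k) := by
    have := Nat.choose_mul_succ_eq m k
    rw [← @Nat.cast_inj ℂ] at this
    push_cast [Nat.cast_sub (hk.trans m.le_succ)] at this
    exact this
  have e2 : (m + 1 : ℂ) * m.choose k = (m + 1).choose (k + 1) * (k + 1) := by
    exact_mod_cast Nat.add_one_mul_choose_eq m k
  constructor
  · field_simp; linear_combination e1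
  · field_simp; linear_combination e2

/-- The diagonal of the partial trace of `S_m` over the last `m - n` qubits: the identity is that
of Leibniz' harmonic triangle. -/
theorem sum_restrict_mul_inv_choose {n m : ℕ} (h : n ≤ m) (G : Cfg n → ℂ) :
    ∑ i : Cfg m, G (restrict h i) * (m.choose (ones i) : ℂ)⁻¹ =
      (m + 1) / (n + 1) * ∑ j : Cfg n, G j * (n.choose (ones j) : ℂ)⁻¹ := by
  induction m, h using Nat.le_induction with
  | base =>
    have : (n + 1 : ℂ) ≠ 0 := by exact_mod_cast n.succ_ne_zero
    rw [div_self this, one_mul]; rfl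
  | succ m h ih =>
    have h3 : (m + 1 : ℂ) ≠ 0 := by exact_mod_cast m.succ_ne_zero
    have h4 : (n + 1 : ℂ) ≠ 0 := by exact_mod_cast n.succ_ne_zero
    rw [sum_cfg_succ h G fun k => ((m + 1).choose k : ℂ)⁻¹]
    have : ∀ j : Cfg m, G (restrict h j) *
        (((m + 1).choose (ones j) : ℂ)⁻¹ + ((m + 1).choose (ones j + 1) : ℂ)⁻¹) =
        (m + 2) / (m + 1) * (G (restrict h j) * (m.choose (ones j) : ℂ)⁻¹) := by
      intro j
      obtain ⟨e1, e2⟩ := choose_succ_cast (ones_le j)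
      rw [e1, e2]; field_simp; ring
    rw [Finset.sum_congr rfl fun j _ => this j, ← Finset.mul_sum, ih]
    push_cast
    field_simp
    ring

/-- The diagonal of the partial trace of `2 L₃ S_m` over the last `m - n` qubits. -/
theorem sum_restrict_mul_wt_mul_inv_choose {n m : ℕ} (h : n ≤ m) (G : Cfg n → ℂ) :
    ∑ i : Cfg m, G (restrict h i) * (wt i * (m.choose (ones i) : ℂ)⁻¹) =
      (m + 1) * (m + 2) / ((n + 1) * (n + 2)) *
        ∑ j : Cfg n, G j * (wt j * (n.choose (ones j) : ℂ)⁻¹) := by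
  induction m, h using Nat.le_induction with
  | base =>
    have : (n + 1 : ℂ) * (n + 2) ≠ 0 := by
      exact_mod_cast (mul_pos n.succ_pos (n + 1).succ_pos).ne'
    rw [div_self this, one_mul]; rfl
  | succ m h ih =>
    have h3 : (m + 1 : ℂ) ≠ 0 := by exact_mod_cast m.succ_ne_zero
    have h4 : (n + 1 : ℂ) ≠ 0 := by exact_mod_cast n.succ_ne_zero
    have h5 : (n + 2 : ℂ) ≠ 0 := by exact_mod_cast (n + 1).succ_ne_zero
    simp only [wt, Complex.ofReal_sub, Complex.ofReal_mul, Complex.ofReal_natCast,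
      Complex.ofReal_ofNat] at ih ⊢
    rw [sum_cfg_succ h G fun k =>
      (((m + 1 : ℕ) : ℂ) - 2 * k) * ((m + 1).choose k : ℂ)⁻¹]
    have : ∀ j : Cfg m, G (restrict h j) *
        ((((m + 1 : ℕ) : ℂ) - 2 * ones j) * ((m + 1).choose (ones j) : ℂ)⁻¹ +
          (((m + 1 : ℕ) : ℂ) - 2 * (ones j + 1 : ℕ)) * ((m + 1).choose (ones j + 1) : ℂ)⁻¹) =
        (m + 3) / (m + 1) *
          (G (restrict h j) * (((m : ℂ) - 2 * ones j) * (m.choose (ones j) : ℂ)⁻¹)) := by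
      intro j
      obtain ⟨e1, e2⟩ := choose_succ_cast (ones_le j)
      rw [e1, e2]; push_cast; field_simp; ring
    rw [Finset.sum_congr rfl fun j _ => this j, ← Finset.mul_sum, ih]
    push_cast
    field_simp
    ring

/-! ### Schur's lemma on the symmetric subspace -/

theorem ones_zero (n : ℕ) : ones (0 : Cfg n) = 0 := by simp [ones]

theorem eq_zero_of_wt_eq {n : ℕ} {j : Cfg n} (h : wt j = wt (0 : Cfg n)) : j = 0 := by
  have h0 : ones j = 0 := by
    have : (ones j : ℝ) = 0 := by simp only [wt, ones_zero] at h; push_cast at h; linarith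
    exact_mod_cast this
  rw [ones, Finset.card_eq_zero, Finset.filter_eq_empty_iff] at h0
  funext k
  have := h0 (Finset.mem_univ k)
  show j k = 0
  omega

/-- The element of `SU(2)` whose first column is the unit vector `φ`. -/
def frame (φ : Fin 2 → ℂ) : Matrix (Fin 2) (Fin 2) ℂ :=
  !![φ 0, -star (φ 1); φ 1, star (φ 0)]

theorem frame_mem {φ : Fin 2 → ℂ} (h : star φ ⬝ᵥ φ = 1) :
    frame φ ∈ Matrix.specialUnitaryGroup (Fin 2) ℂ := by
  simp only [dotProduct, Fin.sum_univ_two, Pi.star_apply, RCLike.star_def] at h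
  rw [Matrix.mem_specialUnitaryGroup_iff, Matrix.mem_unitaryGroup_iff']
  constructor
  · ext a b
    fin_cases a <;> fin_cases b <;>
      simp [frame, Matrix.mul_apply, Fin.sum_univ_two, Matrix.star_eq_conjTranspose]
    · linear_combination h
    · ring
    · ring
    · linear_combination h
  · simp only [frame, Matrix.det_fin_two_of, RCLike.star_def]
    linear_combination h

theorem tensorPow_frame_apply_zero {n : ℕ} (φ : Fin 2 → ℂ) (j : Cfg n) :
    tensorPow n (frame φ) j 0 = ∏ k, φ (j k) := by
  have : ∀ a, frame φ a 0 = φ a := by intro a; fin_cases a <;> rfl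
  simp [tensorPow, this]

/-- An operator on the symmetric subspace that kills all product vectors `φ^{⊗n}` vanishes: for
`φ = (1, t)` up to normalisation, its matrix elements are the coefficients of a polynomial in `t`
without nonzero values on the real line. -/
theorem eq_zero_of_mul_tensorPow_frame {n : ℕ} {Y : Op n} (hS : Y * symProj n = Y)
    (h : ∀ φ : Fin 2 → ℂ, star φ ⬝ᵥ φ = 1 → ∀ i, (Y * tensorPow n (frame φ)) i 0 = 0) :
    Y = 0 := by
  have hperm : ∀ (η : Equiv.Perm (Fin n)) (i j : Cfg n), Y i (j ∘ η) = Y i j := by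
    intro η i j
    have e : Y * permOp η⁻¹ = Y := by
      rw [← hS, Matrix.mul_assoc, symProj_mul_permOp]
    conv_rhs => rw [← e, mul_permOp_apply, inv_inv]
  have hones : ∀ i j j', ones j = ones j' → Y i j = Y i j' := by
    intro i j j' hj
    obtain ⟨η, rfl⟩ := exists_comp_eq_of_ones_eq hj
    exact (hperm η i j).symm
  ext i j
  let p : Polynomial ℂ := ∑ j, Polynomial.monomial (ones j) (Y i j)
  have hp : p = 0 := by
    refine Polynomial.eq_zero_of_infinite_isRoot p
      ((Set.infinite_range_of_injective (f := fun t : ℝ => (t : ℂ))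
        Complex.ofReal_injective).mono ?_)
    rintro _ ⟨t, rfl⟩
    -- `r` normalises `(1, t)`
    have hpos : 0 < 1 + t ^ 2 := by positivity
    set r : ℝ := (Real.sqrt (1 + t ^ 2))⁻¹ with hr
    have hr2 : r * r * (1 + t ^ 2) = 1 := by
      rw [hr, ← mul_inv, Real.mul_self_sqrt hpos.le, inv_mul_cancel₀ hpos.ne']
    have hr0 : (r : ℂ) ≠ 0 := by
      intro e
      have : r = 0 := by exact_mod_cast e
      simp [this] at hr2
    have h1 := h ![(r : ℂ), r * t] (by
      simp only [dotProduct, Fin.sum_univ_two, Pi.star_apply, RCLike.star_def]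
      simp only [Matrix.cons_val_zero, Matrix.cons_val_one, map_mul, Complex.conj_ofReal]
      have : (r : ℂ) * r * (1 + t ^ 2) = 1 := by exact_mod_cast hr2
      linear_combination this) i
    have h2 : ∀ j : Cfg n,
        ∏ k, (![(r : ℂ), r * t] : Fin 2 → ℂ) (j k) = r ^ n * (t : ℂ) ^ ones j := by
      intro j
      have : ∀ a : Fin 2, (![(r : ℂ), r * t] : Fin 2 → ℂ) a = r * if a = 1 then (t : ℂ) else 1 := by
        intro a; fin_cases a <;> simp
      simp only [this, Finset.prod_mul_distrib, Finset.prod_const, Finset.card_univ,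
        Fintype.card_fin, Finset.prod_ite, one_pow, mul_one]
      rfl
    rw [Matrix.mul_apply] at h1
    simp only [tensorPow_frame_apply_zero, h2] at h1
    have h3 : (r : ℂ) ^ n * ∑ j, Y i j * (t : ℂ) ^ ones j = 0 := by
      rw [← h1, Finset.mul_sum]
      exact Finset.sum_congr rfl fun j _ => by ring
    show Polynomial.eval (t : ℂ) p = 0
    simp only [p, Polynomial.eval_finsetSum, Polynomial.eval_monomial]
    exact (mul_eq_zero.mp h3).resolve_left (pow_ne_zero _ hr0)
  have hc : p.coeff (ones j) = 0 := by rw [hp, Polynomial.coeff_zero]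
  simp only [p, Polynomial.finsetSum_coeff, Polynomial.coeff_monomial] at hc
  rw [← Finset.sum_filter, Finset.sum_congr rfl (g := fun _ => Y i j)
    fun j' hj' => hones i j' j (Finset.mem_filter.mp hj').2, Finset.sum_const, nsmul_eq_mul,
    mul_eq_zero] at hc
  refine hc.resolve_left ?_
  exact_mod_cast (Finset.card_pos.mpr ⟨j, by simp⟩).ne'

/-- Schur's lemma: an operator on the symmetric subspace which commutes with `SU(2)` is a multiple
of `S_n`. By weights, it maps `|0…0⟩` to a multiple of itself, hence so for all `φ^{⊗n}`. -/
theorem eq_smul_symProj_of_commute {n : ℕ} {X : Op n} (hS : X * symProj n = X)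
    (hX : ∀ U ∈ Matrix.specialUnitaryGroup (Fin 2) ℂ, tensorPow n U * X = X * tensorPow n U) :
    X = (X.trace / (n + 1)) • symProj n := by
  have key : X = X 0 0 • symProj n := by
    rw [← sub_eq_zero]
    refine eq_zero_of_mul_tensorPow_frame ?_ fun φ hφ i => ?_
    · rw [Matrix.sub_mul, hS, Matrix.smul_mul, symProj_mul_self]
    · have h0 : ∀ j, j ≠ 0 → X j 0 = 0 := fun j hj => by
        by_contra hne
        exact hj (eq_zero_of_wt_eq (wt_eq_of_intertwiner hX hne))
      have h1 : (X * tensorPow n (frame φ)) i 0 = tensorPow n (frame φ) i 0 * X 0 0 := by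
        rw [← hX _ (frame_mem hφ), Matrix.mul_apply]
        exact Finset.sum_eq_single 0 (fun j _ hj => by rw [h0 j hj, mul_zero]) (by simp)
      have h2 : (symProj n * tensorPow n (frame φ)) i 0 = tensorPow n (frame φ) i 0 := by
        have hn : (n.factorial : ℂ) ≠ 0 := by exact_mod_cast n.factorial_ne_zero
        simp only [symProj_eq, Matrix.smul_mul, Finset.sum_mul, Matrix.smul_apply,
          Matrix.sum_apply, permOp_mul_apply, tensorPow_frame_apply_zero, Function.comp_apply]
        have : ∀ η : Equiv.Perm (Fin n), ∏ k, φ (i (η k)) = ∏ k, φ (i k) := fun η =>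
          Equiv.prod_comp η fun k => φ (i k)
        simp [this, Fintype.card_perm, hn]
      rw [Matrix.sub_mul, Matrix.sub_apply, Matrix.smul_mul, Matrix.smul_apply, h1, h2, smul_eq_mul,
        mul_comm, sub_self]
  have hn : (n + 1 : ℂ) ≠ 0 := by exact_mod_cast n.succ_ne_zero
  have ht := congrArg Matrix.trace key
  rw [Matrix.trace_smul, trace_symProj, smul_eq_mul] at ht
  rw [ht, mul_div_cancel_right₀ _ hn]
  exact key

/-! ### The blocks of the natural purifier -/

theorem conjTranspose_mem_specialUnitaryGroup {U : Matrix (Fin 2) (Fin 2) ℂ}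
    (hU : U ∈ Matrix.specialUnitaryGroup (Fin 2) ℂ) :
    Uᴴ ∈ Matrix.specialUnitaryGroup (Fin 2) ℂ := by
  rw [← Matrix.star_eq_conjTranspose]
  rw [Matrix.mem_specialUnitaryGroup_iff] at hU ⊢
  refine ⟨Unitary.star_mem hU.1, ?_⟩
  rw [Matrix.star_eq_conjTranspose, Matrix.det_conjTranspose, hU.2, star_one]

theorem mul_conjTranspose_self_of_mem {U : Matrix (Fin 2) (Fin 2) ℂ}
    (hU : U ∈ Matrix.specialUnitaryGroup (Fin 2) ℂ) : U * Uᴴ = 1 :=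
  Matrix.mem_unitaryGroup_iff.mp (Matrix.mem_specialUnitaryGroup_iff.mp hU).1

theorem trace_conjTranspose_mul_toMat {a b : Type} [Fintype a] [Fintype b]
    (v : EuclideanSpace ℂ (a × b)) :
    ((toMat v)ᴴ * toMat v).trace = ((‖v‖ ^ 2 : ℝ) : ℂ) := by
  rw [EuclideanSpace.norm_sq_eq, Fintype.sum_prod_type_right]
  push_cast
  simp only [Matrix.trace, Matrix.diag_apply, Matrix.mul_apply, Matrix.conjTranspose_apply, toMat,
    LinearMap.coe_mk, AddHom.coe_mk, Matrix.of_apply]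
  refine Finset.sum_congr rfl fun j _ => Finset.sum_congr rfl fun i _ => ?_
  rw [RCLike.star_def, Complex.conj_mul']

/-- A normalised intertwiner is an isometry of `H_s` up to the factor `1 / √(n + 1)`. -/
theorem conjTranspose_mul_toMat_eq {N n : ℕ} {v : EuclideanSpace ℂ (Cfg N × Cfg n)}
    (hv : v ∈ multSpace N n) (h1 : ‖v‖ = 1) :
    (toMat v)ᴴ * toMat v = ((n : ℂ) + 1)⁻¹ • symProj n := by
  obtain ⟨hS, hU⟩ := hv
  have h := eq_smul_symProj_of_commute (X := (toMat v)ᴴ * toMat v)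
    (by rw [Matrix.mul_assoc, hS]) fun U hUm => by
      have e := congrArg Matrix.conjTranspose (hU _ (conjTranspose_mem_specialUnitaryGroup hUm))
      simp only [Matrix.conjTranspose_mul, conjTranspose_tensorPow,
        Matrix.conjTranspose_conjTranspose] at e
      rw [← Matrix.mul_assoc, ← e, Matrix.mul_assoc, hU U hUm, Matrix.mul_assoc]
  rw [h, trace_conjTranspose_mul_toMat, h1]
  simp

/-- The noisy state in direction `U` is, up to normalisation, an element of `SL(2, ℂ)`, so the
block of spin `s` sees the state `U ρ_s(β) U*` with probability `w_N(s)`. -/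
theorem trace_natBlock_mul (N n : ℕ) {β : ℝ} (hβ : 0 < β) (A : Op n)
    {U : Matrix (Fin 2) (Fin 2) ℂ} (hU : U ∈ Matrix.specialUnitaryGroup (Fin 2) ℂ) :
    (natBlock N n A *
      tensorPow N (((2 * Real.cosh β : ℝ) : ℂ)⁻¹ • (U * torus β * Uᴴ))).trace =
      weight N β n * (A * (tensorPow n U * rhoSpin β n * tensorPow n Uᴴ)).trace := by
  have hn : (n + 1 : ℂ) ≠ 0 := by exact_mod_cast n.succ_ne_zero
  have hs : Real.sinh β ≠ 0 := (Real.sinh_pos_iff.mpr hβ).ne'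
  have hs' : Real.sinh ((n + 1) * β) ≠ 0 := (Real.sinh_pos_iff.mpr (by positivity)).ne'
  have hc : Real.cosh β ≠ 0 := (Real.cosh_pos β).ne'
  have key : ∀ k, (toMat (stdOrthonormalBasis ℂ (multSpace N n) k :
        EuclideanSpace ℂ (Cfg N × Cfg n)) * A *
      (toMat (stdOrthonormalBasis ℂ (multSpace N n) k :
        EuclideanSpace ℂ (Cfg N × Cfg n)))ᴴ * tensorPow N (U * torus β * Uᴴ)).trace =
      (n + 1 : ℂ)⁻¹ *
        (A * (tensorPow n U * (symProj n * tensorPow n (torus β)) * tensorPow n Uᴴ)).trace := by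
    intro k
    have hm := (stdOrthonormalBasis ℂ (multSpace N n) k).2
    have h1 : ‖(stdOrthonormalBasis ℂ (multSpace N n) k : EuclideanSpace ℂ (Cfg N × Cfg n))‖ = 1 :=
      (stdOrthonormalBasis ℂ (multSpace N n)).orthonormal.1 k
    generalize (stdOrthonormalBasis ℂ (multSpace N n) k : EuclideanSpace ℂ (Cfg N × Cfg n)) = v
      at hm h1 ⊢
    have hVV := conjTranspose_mul_toMat_eq hm h1
    obtain ⟨-, hI⟩ := hm
    have e : tensorPow N (U * torus β * Uᴴ) * toMat v =
        toMat v * tensorPow n (U * torus β * Uᴴ) := by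
      simp only [← tensorPow_mul]
      rw [Matrix.mul_assoc, hI _ (conjTranspose_mem_specialUnitaryGroup hU), ← Matrix.mul_assoc,
        Matrix.mul_assoc (tensorPow N U), tensorPow_torus_mul hI, ← Matrix.mul_assoc,
        hI U hU]
      simp only [Matrix.mul_assoc]
    rw [Matrix.mul_assoc, Matrix.mul_assoc, Matrix.trace_mul_comm, Matrix.mul_assoc,
      Matrix.mul_assoc, e, ← Matrix.mul_assoc (toMat v)ᴴ, hVV, ← tensorPow_mul, ← tensorPow_mul,
      Matrix.smul_mul, Matrix.mul_smul, Matrix.trace_smul, smul_eq_mul]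
    congr 3
    simp only [← Matrix.mul_assoc]
    rw [symProj_mul_tensorPow]
  simp only [natBlock, LinearMap.coe_mk, AddHom.coe_mk, tensorPow_smul, Matrix.smul_mul,
    Matrix.mul_smul, Matrix.trace_smul, Finset.sum_mul, Matrix.trace_sum, key, Finset.sum_const,
    Finset.card_univ, Fintype.card_fin, rhoSpin, exp_two_mul_smul_L3, nsmul_eq_mul, smul_eq_mul,
    weight]
  have hs2 : Complex.sinh β ≠ 0 := by exact_mod_cast hs
  have hs3 : Complex.sinh ((n + 1) * β) ≠ 0 := by exact_mod_cast hs'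
  have hc2 : Complex.cosh β ≠ 0 := by exact_mod_cast hc
  push_cast
  rw [inv_pow]
  generalize (A * (tensorPow n U * (symProj n * tensorPow n (torus β)) * tensorPow n Uᴴ)).trace = t
  field_simp

/-! ### Traces of `Q̂` against `ρ_s(β)` -/

/-- The partition function of `ρ_s(β)`. -/
theorem sum_exp_weights (n : ℕ) {β : ℝ} (hβ : β ≠ 0) :
    ∑ m ∈ Finset.range (n + 1), Real.exp (β * (n - 2 * m)) =
      Real.sinh ((n + 1) * β) / Real.sinh β := by
  have hs : Real.sinh β ≠ 0 := fun h => hβ (Real.sinh_eq_zero.mp h)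
  rw [eq_div_iff hs]
  -- the sum telescopes after multiplication by `2 sinh β`
  have h : ∀ m ∈ Finset.range (n + 1), Real.exp (β * (n - 2 * m)) * Real.sinh β =
      Real.exp (β * (n + 1 - 2 * m)) / 2 - Real.exp (β * (n + 1 - 2 * (m + 1 : ℕ))) / 2 := by
    intro m _
    rw [Real.sinh_eq, show β * (n + 1 - 2 * m : ℝ) = β * (n - 2 * m) + β by ring,
      show β * (n + 1 - 2 * (m + 1 : ℕ) : ℝ) = β * (n - 2 * m) + -β by push_cast; ring,
      Real.exp_add, Real.exp_add]
    ring
  rw [Finset.sum_mul, Finset.sum_congr rfl h,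
    Finset.sum_range_sub' (fun m : ℕ => Real.exp (β * (n + 1 - 2 * m)) / 2), Real.sinh_eq,
    sub_div]
  congr 3 <;> push_cast <;> ring

/-- The logarithmic derivative of the partition function. -/
theorem sum_weights_mul_exp (n : ℕ) {β : ℝ} (hβ : 0 < β) :
    ∑ m ∈ Finset.range (n + 1), ((n : ℝ) - 2 * m) * Real.exp (β * (n - 2 * m)) =
      Real.sinh ((n + 1) * β) / Real.sinh β *
        ((n + 1) * coth ((n + 1) * β) - coth β) := by
  have hs : Real.sinh β ≠ 0 := (Real.sinh_pos_iff.mpr hβ).ne'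
  have hs' : Real.sinh ((n + 1) * β) ≠ 0 := (Real.sinh_pos_iff.mpr (by positivity)).ne'
  have h1 : HasDerivAt (fun b : ℝ => ∑ m ∈ Finset.range (n + 1), Real.exp (b * (n - 2 * m)))
      (∑ m ∈ Finset.range (n + 1), ((n : ℝ) - 2 * m) * Real.exp (β * (n - 2 * m))) β := by
    refine HasDerivAt.fun_sum fun m _ => ?_
    have := ((hasDerivAt_id β).mul_const ((n : ℝ) - 2 * m)).exp
    simpa [mul_comm] using this
  have h2 : HasDerivAt (fun b : ℝ => Real.sinh ((n + 1) * b) / Real.sinh b)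
      ((Real.cosh ((n + 1) * β) * (n + 1) * Real.sinh β -
        Real.sinh ((n + 1) * β) * Real.cosh β) / Real.sinh β ^ 2) β := by
    refine HasDerivAt.fun_div ?_ (Real.hasDerivAt_sinh β) hs
    have := ((hasDerivAt_id β).const_mul ((n : ℝ) + 1)).sinh
    simpa using this
  -- the closed form fails at `b = 0`, so the functions agree only near `β`
  have h3 : (fun b : ℝ => ∑ m ∈ Finset.range (n + 1), Real.exp (b * (n - 2 * m))) =ᶠ[nhds β]
      fun b : ℝ => Real.sinh ((n + 1) * b) / Real.sinh b := by
    filter_upwards [isOpen_ne.mem_nhds hβ.ne'] with b hb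
    exact sum_exp_weights n hb
  rw [(h3.hasDerivAt_iff.mp h1).unique h2, coth, coth]
  field_simp

theorem rhoSpin_eq (β : ℝ) (n : ℕ) :
    rhoSpin β n = ((Real.sinh β / Real.sinh ((n + 1) * β) : ℝ) : ℂ) •
      (symProj n * tensorPow n (torus β)) := by
  rw [rhoSpin, exp_two_mul_smul_L3]

theorem symProj_mul_rhoSpin (β : ℝ) (n : ℕ) : symProj n * rhoSpin β n = rhoSpin β n := by
  rw [rhoSpin_eq, Matrix.mul_smul, ← Matrix.mul_assoc, symProj_mul_self]

theorem rhoSpin_mul_symProj (β : ℝ) (n : ℕ) : rhoSpin β n * symProj n = rhoSpin β n := by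
  rw [rhoSpin_eq, Matrix.smul_mul, Matrix.mul_assoc, ← symProj_mul_tensorPow, ← Matrix.mul_assoc,
    symProj_mul_self]

theorem trace_symProj_mul_diagonal_mul_diagonal {n : ℕ} (d e : Cfg n → ℂ) :
    (Matrix.diagonal d * (symProj n * Matrix.diagonal e)).trace =
      ∑ i, e i * (d i * (n.choose (ones i) : ℂ)⁻¹) := by
  rw [Matrix.trace]
  refine Finset.sum_congr rfl fun i _ => ?_
  rw [Matrix.diag_apply, Matrix.diagonal_mul, Matrix.mul_diagonal, symProj_apply_self]
  ring

theorem sum_exp_wt (n : ℕ) {β : ℝ} (hβ : 0 < β) :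
    ∑ i : Cfg n, Complex.exp (β * wt i) * (n.choose (ones i) : ℂ)⁻¹ =
      ((Real.sinh ((n + 1) * β) / Real.sinh β : ℝ) : ℂ) := by
  rw [← sum_exp_weights n hβ.ne']
  have := sum_inv_choose_mul n fun m => Complex.exp (β * (n - 2 * m))
  push_cast
  rw [← this]
  refine Finset.sum_congr rfl fun i _ => ?_
  rw [mul_comm]
  simp [wt]

theorem sum_exp_wt_mul_wt (n : ℕ) {β : ℝ} (hβ : 0 < β) :
    ∑ i : Cfg n, Complex.exp (β * wt i) * (wt i * (n.choose (ones i) : ℂ)⁻¹) =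
      ((Real.sinh ((n + 1) * β) / Real.sinh β *
        ((n + 1) * coth ((n + 1) * β) - coth β) : ℝ) : ℂ) := by
  rw [← sum_weights_mul_exp n hβ]
  have := sum_inv_choose_mul n fun m => (n - 2 * m) * Complex.exp (β * (n - 2 * m))
  push_cast
  rw [← this]
  refine Finset.sum_congr rfl fun i _ => ?_
  simp only [wt]
  push_cast
  ring

theorem trace_rhoSpin (n : ℕ) {β : ℝ} (hβ : 0 < β) : (rhoSpin β n).trace = 1 := by
  have hs : Real.sinh β ≠ 0 := (Real.sinh_pos_iff.mpr hβ).ne'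
  have hs' : Real.sinh ((n + 1) * β) ≠ 0 := (Real.sinh_pos_iff.mpr (by positivity)).ne'
  have h := trace_symProj_mul_diagonal_mul_diagonal (n := n) (fun _ => 1)
    fun i => Complex.exp (β * wt i)
  simp only [one_mul, Matrix.diagonal_one] at h
  rw [rhoSpin_eq, Matrix.trace_smul, tensorPow_torus, h, sum_exp_wt n hβ, smul_eq_mul]
  rw [← Complex.ofReal_mul]
  exact_mod_cast (by field_simp)

theorem trace_two_smul_L3_mul_rhoSpin (n : ℕ) {β : ℝ} (hβ : 0 < β) :
    ((2 : ℂ) • L3 n * rhoSpin β n).trace =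
      (((n + 1) * coth ((n + 1) * β) - coth β : ℝ) : ℂ) := by
  have hs : Real.sinh β ≠ 0 := (Real.sinh_pos_iff.mpr hβ).ne'
  have hs' : Real.sinh ((n + 1) * β) ≠ 0 := (Real.sinh_pos_iff.mpr (by positivity)).ne'
  rw [rhoSpin_eq, Matrix.mul_smul, Matrix.trace_smul, tensorPow_torus, two_smul_L3,
    trace_symProj_mul_diagonal_mul_diagonal, sum_exp_wt_mul_wt n hβ, smul_eq_mul,
    ← Complex.ofReal_mul]
  congr 1
  field_simp

theorem hatQ_of_lt {M n : ℕ} (h : n < M) : hatQ M n = traceDual (clonePredual h.le) := by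
  rw [hatQ, dif_pos h]

theorem hatQ_of_le {M n : ℕ} (h : M ≤ n) : hatQ M n = discard h := by
  rw [hatQ, dif_neg (not_lt.mpr h)]

theorem trace_traceDual_mul {a b : Type} [Fintype a] [DecidableEq a] [Fintype b] [DecidableEq b]
    (T : Matrix a a ℂ →ₗ[ℂ] Matrix b b ℂ) (X : Matrix b b ℂ) (ρ : Matrix a a ℂ) :
    (traceDual T X * ρ).trace = (X * T ρ).trace := by
  rw [Matrix.trace_mul_comm, ← trace_mul_traceDual, Matrix.trace_mul_comm]

theorem clonePredual_rhoSpin {n M : ℕ} (h : n ≤ M) (β : ℝ) :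
    clonePredual h (rhoSpin β n) =
      (((n : ℂ) + 1) / ((M : ℂ) + 1)) •
        (symProj M * tensorOne h (rhoSpin β n) * symProj M) := by
  simp only [clonePredual, LinearMap.coe_mk, AddHom.coe_mk, symProj_mul_rhoSpin,
    rhoSpin_mul_symProj]

theorem tensorOne_diagonal {n m : ℕ} (h : n ≤ m) (d : Cfg n → ℂ) :
    tensorOne h (Matrix.diagonal d) = Matrix.diagonal fun i => d (restrict h i) := by
  ext i j
  simp only [tensorOne, LinearMap.coe_mk, AddHom.coe_mk, Matrix.of_apply]
  by_cases hij : i = j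
  · subst hij; simp; rfl
  · rw [Matrix.diagonal_apply_ne _ hij]
    by_cases hr : restrict h i = restrict h j
    · rw [if_neg, mul_zero]
      intro hl
      refine hij (funext fun l => ?_)
      by_cases hln : n ≤ (l : ℕ)
      · exact hl l hln
      · exact congrFun hr ⟨l, not_le.mp hln⟩
    · exact mul_eq_zero_of_left (Matrix.diagonal_apply_ne _ hr) _

/-- The cloned `ρ_s(β)` seen by a diagonal observable which commutes with `S_M`. -/
theorem trace_diagonal_mul_clonePredual_rhoSpin {n M : ℕ} (h : n ≤ M) (β : ℝ) {d : Cfg M → ℂ}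
    (hd : Matrix.diagonal d * symProj M = symProj M * Matrix.diagonal d) :
    (Matrix.diagonal d * clonePredual h (rhoSpin β n)).trace =
      ((n + 1) / (M + 1) : ℂ) * (((Real.sinh β / Real.sinh ((n + 1) * β) : ℝ) : ℂ) *
        ∑ i : Cfg M, Complex.exp (β * wt (restrict h i)) *
          (d i * (M.choose (ones i) : ℂ)⁻¹)) := by
  have e : symProj M * tensorOne h (rhoSpin β n) =
      ((Real.sinh β / Real.sinh ((n + 1) * β) : ℝ) : ℂ) •
        (symProj M * Matrix.diagonal fun i => Complex.exp (β * wt (restrict h i))) := by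
    rw [rhoSpin_eq, map_smul, tensorOne_mul, Matrix.mul_smul, ← Matrix.mul_assoc,
      symProj_mul_tensorOne_symProj, tensorPow_torus, tensorOne_diagonal]
  rw [clonePredual_rhoSpin, Matrix.mul_smul, Matrix.trace_smul, smul_eq_mul]
  congr 1
  calc (Matrix.diagonal d * (symProj M * tensorOne h (rhoSpin β n) * symProj M)).trace
      = (symProj M * (Matrix.diagonal d * symProj M) * tensorOne h (rhoSpin β n)).trace := by
        rw [← Matrix.mul_assoc, Matrix.trace_mul_comm]
        simp only [Matrix.mul_assoc]
    _ = (Matrix.diagonal d * (symProj M * tensorOne h (rhoSpin β n))).trace := by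
        rw [hd, ← Matrix.mul_assoc (symProj M), symProj_mul_self, ← hd, Matrix.mul_assoc]
    _ = _ := by
        rw [e, Matrix.mul_smul, Matrix.trace_smul, trace_symProj_mul_diagonal_mul_diagonal,
          smul_eq_mul]

theorem symProj_mul_two_smul_L3 (n : ℕ) :
    symProj n * ((2 : ℂ) • L3 n) = (2 : ℂ) • L3 n * symProj n := by
  have h : ∀ η : Equiv.Perm (Fin n), permOp η * ((2 : ℂ) • L3 n) =
      (2 : ℂ) • L3 n * permOp η := by
    intro η
    ext i j
    rw [two_smul_L3, Matrix.mul_diagonal, Matrix.diagonal_mul]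
    by_cases hij : i ∘ η = j
    · subst hij; rw [mul_comm, wt, wt, ones_comp]
    · simp [permOp, hij]
  simp only [symProj_eq, Matrix.smul_mul (_ : ℂ) (∑ _, _), Matrix.mul_smul _ (_ : ℂ) (∑ _, _),
    Finset.sum_mul, Finset.mul_sum, h]

theorem onSite_one {n : ℕ} (k : Fin n) : onSite k 1 = 1 := by
  rw [onSite_eq_prodOp, ← prodOp_one]
  congr 1
  exact Function.update_eq_self k 1

/-- Discarding `n - M` of `n` symmetric qubits scales the angular momentum by `M / n`. -/
theorem discard_two_smul_L3 {M n : ℕ} (h : M ≤ n) (hn : n ≠ 0) :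
    discard h ((2 : ℂ) • L3 M) = (M / n : ℂ) • (symProj n * ((2 : ℂ) • L3 n) * symProj n) := by
  have hn' : (n : ℂ) ≠ 0 := by exact_mod_cast hn
  obtain ⟨k⟩ : Nonempty (Fin n) := ⟨⟨0, Nat.pos_of_ne_zero hn⟩⟩
  have e : ∀ m : ℕ, (2 : ℂ) • L3 m = ∑ k : Fin m, onSite k pauli3 := fun m => by
    rw [L3, smul_smul]; norm_num
  have e1 : ∀ l : Fin n, symProj n * onSite l pauli3 * symProj n =
      symProj n * onSite k pauli3 * symProj n := fun l => symProj_onSite_symProj l k _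
  rw [e, e, map_sum]
  simp only [discard, LinearMap.coe_mk, AddHom.coe_mk, tensorOne_onSite, e1, Finset.mul_sum,
    Finset.sum_mul, Finset.sum_const, Finset.card_univ, Fintype.card_fin,
    ← Nat.cast_smul_eq_nsmul ℂ, smul_smul]
  rw [div_mul_cancel₀ _ hn']

theorem trace_hatQ_one_mul_rhoSpin (M n : ℕ) {β : ℝ} (hβ : 0 < β) :
    (hatQ M n 1 * rhoSpin β n).trace = 1 := by
  rcases lt_or_ge n M with h | h
  · have h3 : (M + 1 : ℂ) ≠ 0 := by exact_mod_cast M.succ_ne_zero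
    have h4 : (n + 1 : ℂ) ≠ 0 := by exact_mod_cast n.succ_ne_zero
    have hs : Real.sinh β ≠ 0 := (Real.sinh_pos_iff.mpr hβ).ne'
    have hs' : Real.sinh ((n + 1) * β) ≠ 0 := (Real.sinh_pos_iff.mpr (by positivity)).ne'
    have hs2 : Complex.sinh β ≠ 0 := by exact_mod_cast hs
    have hs3 : Complex.sinh ((n + 1) * β) ≠ 0 := by exact_mod_cast hs'
    have e := trace_diagonal_mul_clonePredual_rhoSpin h.le β (d := fun _ => 1) (by simp)
    simp only [Matrix.diagonal_one, one_mul] at e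
    rw [hatQ_of_lt h, trace_traceDual_mul, Matrix.one_mul, e,
      sum_restrict_mul_inv_choose h.le fun j => Complex.exp (β * wt j), sum_exp_wt n hβ]
    push_cast
    field_simp
  · rw [hatQ_of_le h]
    simp only [discard, LinearMap.coe_mk, AddHom.coe_mk, tensorOne_one, Matrix.mul_one,
      symProj_mul_self, symProj_mul_rhoSpin]
    exact trace_rhoSpin n hβ

theorem trace_hatQ_two_smul_L3_mul_rhoSpin_of_lt {M n : ℕ} (h : n < M) {β : ℝ} (hβ : 0 < β) :
    (hatQ M n ((2 : ℂ) • L3 M) * rhoSpin β n).trace =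
      (((M + 2) / (n + 2) * ((n + 1) * coth ((n + 1) * β) - coth β) : ℝ) : ℂ) := by
  have h3 : (M + 1 : ℂ) ≠ 0 := by exact_mod_cast M.succ_ne_zero
  have h4 : (n + 1 : ℂ) ≠ 0 := by exact_mod_cast n.succ_ne_zero
  have h5 : (n + 2 : ℂ) ≠ 0 := by exact_mod_cast (n + 1).succ_ne_zero
  have hs : Real.sinh β ≠ 0 := (Real.sinh_pos_iff.mpr hβ).ne'
  have hs' : Real.sinh ((n + 1) * β) ≠ 0 := (Real.sinh_pos_iff.mpr (by positivity)).ne'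
  have hs2 : Complex.sinh β ≠ 0 := by exact_mod_cast hs
  have hs3 : Complex.sinh ((n + 1) * β) ≠ 0 := by exact_mod_cast hs'
  have e := trace_diagonal_mul_clonePredual_rhoSpin h.le β (d := fun i => wt i)
    (by rw [← two_smul_L3, symProj_mul_two_smul_L3])
  rw [hatQ_of_lt h, trace_traceDual_mul, two_smul_L3, e,
    sum_restrict_mul_wt_mul_inv_choose h.le fun j => Complex.exp (β * wt j),
    sum_exp_wt_mul_wt n hβ]
  push_cast
  field_simp

theorem trace_hatQ_two_smul_L3_mul_rhoSpin_of_le {M n : ℕ} (h : M ≤ n) (hn : n ≠ 0) {β : ℝ}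
    (hβ : 0 < β) :
    (hatQ M n ((2 : ℂ) • L3 M) * rhoSpin β n).trace =
      ((M / n * ((n + 1) * coth ((n + 1) * β) - coth β) : ℝ) : ℂ) := by
  rw [hatQ_of_le h, discard_two_smul_L3 h hn, symProj_mul_two_smul_L3,
    Matrix.mul_assoc _ (symProj n), symProj_mul_self, Matrix.smul_mul, Matrix.mul_assoc,
    symProj_mul_rhoSpin, Matrix.trace_smul,
    trace_two_smul_L3_mul_rhoSpin n hβ]
  push_cast
  rfl

theorem two_mul_fOne_sub_one (M : ℕ) (β : ℝ) (n : ℕ) :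
    2 * fOne M β n - 1 = 1 / M * (hatQ M n ((2 : ℂ) • L3 M) * rhoSpin β n).trace.re := by
  rw [fOne, gammaParam, ← trace_mul_traceDual]
  ring

/-! ### Covariance and symmetry of `Q̂` -/

theorem symProj_conj {n : ℕ} (A : Matrix (Fin 2) (Fin 2) ℂ) (B : Matrix (Fin 2) (Fin 2) ℂ)
    (X : Op n) :
    symProj n * (tensorPow n A * X * tensorPow n B) * symProj n =
      tensorPow n A * (symProj n * X * symProj n) * tensorPow n B := by
  simp only [← Matrix.mul_assoc, symProj_mul_tensorPow]
  simp only [Matrix.mul_assoc, symProj_mul_tensorPow]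

/-- `Q̂` intertwines the actions of `SU(2)`. -/
theorem trace_hatQ_conj_mul {M n : ℕ} {U V : Matrix (Fin 2) (Fin 2) ℂ} (hUV : U * V = 1)
    (A : Op M) (X : Op n) :
    (hatQ M n (tensorPow M U * A * tensorPow M V) *
        (tensorPow n U * X * tensorPow n V)).trace = (hatQ M n A * X).trace := by
  have hVU : V * U = 1 := mul_eq_one_comm.mp hUV
  have hcyc : ∀ {m : ℕ} (P R : Op m),
      ((tensorPow m U * P * tensorPow m V) * (tensorPow m U * R * tensorPow m V)).trace =
        (P * R).trace := by
    intro m P R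
    have e : (tensorPow m U * P * tensorPow m V) * (tensorPow m U * R * tensorPow m V) =
        tensorPow m U * (P * (tensorPow m V * tensorPow m U) * R * tensorPow m V) := by
      simp only [Matrix.mul_assoc]
    rw [e, Matrix.trace_mul_comm, Matrix.mul_assoc _ (tensorPow m V), tensorPow_mul, hVU,
      tensorPow_one, Matrix.mul_one, Matrix.mul_one]
  rcases lt_or_ge n M with h | h
  · have e : clonePredual h.le (tensorPow n U * X * tensorPow n V) =
        tensorPow M U * clonePredual h.le X * tensorPow M V := by
      simp only [clonePredual, LinearMap.coe_mk, AddHom.coe_mk, symProj_conj,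
        tensorOne_conj h.le hUV, Matrix.mul_smul, Matrix.smul_mul]
    rw [hatQ_of_lt h, trace_traceDual_mul, trace_traceDual_mul, e, hcyc]
  · have e : discard h (tensorPow M U * A * tensorPow M V) =
        tensorPow n U * discard h A * tensorPow n V := by
      simp only [discard, LinearMap.coe_mk, AddHom.coe_mk, symProj_conj, tensorOne_conj h hUV]
    rw [hatQ_of_le h, e, hcyc]

/-- `Q̂` does not distinguish the `M` output qubits. -/
theorem hatQ_onSite_mul {M n : ℕ} (k l : Fin M) (A : Matrix (Fin 2) (Fin 2) ℂ) (X : Op n) :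
    (hatQ M n (onSite k A) * X).trace = (hatQ M n (onSite l A) * X).trace := by
  rcases lt_or_ge n M with h | h
  · have e : ∀ (B : Op M), (B * clonePredual h.le X).trace =
        (((n : ℂ) + 1) / ((M : ℂ) + 1)) *
          ((symProj M * B * symProj M) * tensorOne h.le (symProj n * X * symProj n)).trace := by
      intro B
      simp only [clonePredual, LinearMap.coe_mk, AddHom.coe_mk, Matrix.mul_smul,
        Matrix.trace_smul, smul_eq_mul]
      rw [← Matrix.mul_assoc, Matrix.trace_mul_comm]
      simp only [Matrix.mul_assoc]
    rw [hatQ_of_lt h, trace_traceDual_mul, trace_traceDual_mul, e, e, symProj_onSite_symProj k l]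
  · rw [hatQ_of_le h]
    simp only [discard, LinearMap.coe_mk, AddHom.coe_mk, tensorOne_onSite]
    rw [symProj_onSite_symProj (Fin.castLE h k) (Fin.castLE h l)]

/-- The fidelity of every single output qubit is `f_one`: all output qubits are alike,
`tr (Q̂(1) ρ_s(β)) = 1`, and `|0⟩⟨0| = (1 + σ₃) / 2`. -/
theorem trace_hatQ_onSite_mul_rhoSpin {M : ℕ} (n : ℕ) {β : ℝ} (hβ : 0 < β) (k : Fin M) :
    (hatQ M n (onSite k (Matrix.single 0 0 1)) * rhoSpin β n).trace.re = fOne M β n := by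
  have hM : (M : ℝ) ≠ 0 := by
    have := k.pos; positivity
  have e1 : (onSite k (Matrix.single 0 0 1) : Op M) =
      (1 / 2 : ℂ) • (1 : Op M) + (1 / 2 : ℂ) • onSite k pauli3 := by
    have : (Matrix.single 0 0 1 : Matrix (Fin 2) (Fin 2) ℂ) =
        (1 / 2 : ℂ) • (1 : Matrix (Fin 2) (Fin 2) ℂ) + (1 / 2 : ℂ) • pauli3 := by
      ext a b
      fin_cases a <;> fin_cases b <;> norm_num [pauli3]
    rw [this, ← onSite_one k]
    ext i j
    simp only [onSite, Matrix.of_apply, Matrix.add_apply, Matrix.smul_apply, smul_eq_mul]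
    ring
  have e2 : (hatQ M n ((2 : ℂ) • L3 M) * rhoSpin β n).trace =
      M * (hatQ M n (onSite k pauli3) * rhoSpin β n).trace := by
    have : (2 : ℂ) • L3 M = ∑ l : Fin M, onSite l pauli3 := by rw [L3, smul_smul]; norm_num
    rw [this, map_sum, Finset.sum_mul, Matrix.trace_sum,
      Finset.sum_congr rfl fun l _ => hatQ_onSite_mul l k pauli3 (rhoSpin β n)]
    simp
  have e3 := two_mul_fOne_sub_one M β n
  rw [e2, ← Complex.ofReal_natCast, Complex.re_ofReal_mul] at e3
  rw [e1, map_add, map_smul, map_smul, Matrix.add_mul, Matrix.smul_mul, Matrix.smul_mul,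
    Matrix.trace_add, Matrix.trace_smul, Matrix.trace_smul, trace_hatQ_one_mul_rhoSpin M n hβ]
  have e4 : ∀ t : ℂ, ((1 / 2 : ℂ) • (1 : ℂ) + (1 / 2 : ℂ) • t).re = (1 + t.re) / 2 := by
    intro t
    rw [smul_eq_mul, smul_eq_mul, show (1 / 2 * 1 + 1 / 2 * t : ℂ) = ((1 / 2 : ℝ) : ℂ) * (1 + t) by
      push_cast; ring, Complex.re_ofReal_mul, Complex.add_re, Complex.one_re]
    ring
  rw [e4]
  field_simp at e3
  linarith

/-! ### The fidelity of the optimal purifier -/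

theorem frame_mul_single_mul_conjTranspose (φ : Fin 2 → ℂ) :
    frame φ * Matrix.single 0 0 1 * (frame φ)ᴴ = Matrix.vecMulVec φ (star φ) := by
  have : (Matrix.single 0 0 1 : Matrix (Fin 2) (Fin 2) ℂ) = !![1, 0; 0, 0] := by
    ext a b
    fin_cases a <;> fin_cases b <;> simp
  rw [this]
  ext a b
  fin_cases a <;> fin_cases b <;>
    simp [frame, Matrix.mul_apply, Fin.sum_univ_two, Matrix.vecMulVec_apply]

/-- A depolarized pure state is a thermal state in the direction of the pure state. -/
theorem depolarize_tanh_vecMulVec {φ : Fin 2 → ℂ} (hφ : star φ ⬝ᵥ φ = 1) (β : ℝ) :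
    depolarize (Real.tanh β) (Matrix.vecMulVec φ (star φ)) =
      ((2 * Real.cosh β : ℝ) : ℂ)⁻¹ • (frame φ * torus β * (frame φ)ᴴ) := by
  have ht : torus β = (2 * Complex.sinh β) • Matrix.single 0 0 1 +
      Complex.exp (-β) • (1 : Matrix (Fin 2) (Fin 2) ℂ) := by
    ext a b
    fin_cases a <;> fin_cases b <;> simp [torus, Complex.sinh]
    ring
  have hc : Complex.cosh β ≠ 0 := by exact_mod_cast (Real.cosh_pos β).ne'
  rw [ht, Matrix.mul_add, Matrix.add_mul, Matrix.mul_smul, Matrix.smul_mul,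
    frame_mul_single_mul_conjTranspose, Matrix.mul_smul, Matrix.smul_mul, Matrix.mul_one,
    mul_conjTranspose_self_of_mem (frame_mem hφ), smul_add, smul_smul, smul_smul, depolarize,
    ← Complex.cosh_sub_sinh]
  push_cast
  rw [Complex.tanh_eq_sinh_div_cosh]
  congr 2
  · field_simp
  · field_simp

/-- The fidelity of the optimal purifier does not depend on the pure state or the output qubit. -/
theorem trace_onSite_mul_traceDual_optPurifier {N M : ℕ} {β : ℝ} (hβ : 0 < β) (k : Fin M)
    {φ : Fin 2 → ℂ} (hφ : star φ ⬝ᵥ φ = 1) :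
    (onSite k (Matrix.vecMulVec φ (star φ)) * traceDual (optPurifier N M)
        (tensorPow N (depolarize (Real.tanh β) (Matrix.vecMulVec φ (star φ))))).trace.re =
      ∑ n ∈ twoSpins N, weight N β n * fOne M β n := by
  have hU := frame_mem hφ
  have hUU := mul_conjTranspose_self_of_mem hU
  rw [← trace_mul_traceDual, depolarize_tanh_vecMulVec hφ, ← frame_mul_single_mul_conjTranspose,
    onSite_conj k hUU]
  simp only [optPurifier, natPurifier, LinearMap.comp_apply, LinearMap.sum_apply,
    LinearMap.proj_apply, LinearMap.pi_apply, Finset.sum_mul, Matrix.trace_sum,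
    trace_natBlock_mul _ _ hβ _ hU, trace_hatQ_conj_mul hUU, Complex.re_sum,
    Complex.re_ofReal_mul, trace_hatQ_onSite_mul_rhoSpin _ hβ k]
  exact Finset.sum_coe_sort (twoSpins N) fun n => weight N β n * fOne M β n

theorem fidelityOne_optPurifier (N : ℕ) {M : ℕ} (hM : 1 ≤ M) {β : ℝ} (hβ : 0 < β) :
    fidelityOne (Real.tanh β) (optPurifier N M) =
      ∑ n ∈ twoSpins N, weight N β n * fOne M β n := by
  have : Nonempty (Fin M) := ⟨⟨0, hM⟩⟩
  have : Nonempty pureStates := ⟨⟨_, Pi.single 0 1, by simp, rfl⟩⟩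
  have h : ∀ (k : Fin M) (σ : pureStates), (onSite k σ.1 * traceDual (optPurifier N M)
      (tensorPow N (depolarize (Real.tanh β) σ.1))).trace.re =
        ∑ n ∈ twoSpins N, weight N β n * fOne M β n := by
    rintro k ⟨_, φ, hφ, rfl⟩
    exact trace_onSite_mul_traceDual_optPurifier hβ k hφ
  simp only [fidelityOne, h, ciInf_const]

end QubitPurification

end

theorem mainTheorem4 (N M : ℕ) (hM : 1 ≤ M) (β : ℝ) (hβ : 0 < β) :
    QubitPurification.fidelityOne (Real.tanh β) (QubitPurification.optPurifier N M) =
        ∑ n ∈ QubitPurification.twoSpins N,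
          QubitPurification.weight N β n * QubitPurification.fOne M β n ∧
      ∀ n : ℕ,
        (M < n →
          2 * QubitPurification.fOne M β n - 1 =
            ((n : ℝ) + 1) / n * QubitPurification.coth (((n : ℝ) + 1) * β) -
              1 / n * QubitPurification.coth β) ∧
        (n ≤ M →
          2 * QubitPurification.fOne M β n - 1 =
            1 / ((n : ℝ) + 2) * (((M : ℝ) + 2) / M) *
              (((n : ℝ) + 1) * QubitPurification.coth (((n : ℝ) + 1) * β) -
                QubitPurification.coth β)) := by
  have hM0 : (M : ℝ) ≠ 0 := by positivity
  refine ⟨QubitPurification.fidelityOne_optPurifier N hM hβ, fun n => ⟨fun h => ?_, fun h => ?_⟩⟩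
  · have hn : n ≠ 0 := by omega
    have hn0 : (n : ℝ) ≠ 0 := by exact_mod_cast hn
    rw [QubitPurification.two_mul_fOne_sub_one,
      QubitPurification.trace_hatQ_two_smul_L3_mul_rhoSpin_of_le h.le hn hβ, Complex.ofReal_re]
    field_simp
  · have hn2 : (n : ℝ) + 2 ≠ 0 := by positivity
    rw [QubitPurification.two_mul_fOne_sub_one]
    rcases h.lt_or_eq with h | rfl
    · rw [QubitPurification.trace_hatQ_two_smul_L3_mul_rhoSpin_of_lt h hβ, Complex.ofReal_re]
      field_simp
    · -- for `n = M` nothing is discarded, and both formulas agree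
      rw [QubitPurification.trace_hatQ_two_smul_L3_mul_rhoSpin_of_le le_rfl (by omega) hβ,
        Complex.ofReal_re]
      field_simp
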